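/- **Setting.** Let $d\in\mathbb N$, $T>0$, $a>0$, $\varepsilon\in(0,2]$, $q_t=(T-t+1)^{-1}$ and $U(x)=-\frac1a e^{-ax}$. Let $\mathbb S^d_+$ be the set of symmetric positive definite $d\times d$ matrices, with the metric of the operator $2$-norm $\|\cdot\|_2$, and let $\mathcal L$ be the set of Lévy measures on $\mathbb R^d$ (Borel measures $\mu$ with $\mu(\{0\})=0$ and $\int(|z|^2\wedge1)\,\mu(dz)<\infty$). For $\mu\in\mathcal L$ let $\hat\mu(dz)=(|z|^{2-\varepsilon}\wedge1)\,\mu(dz)$. Put $$d^\varepsilon_{\mathcal L}(\mu,\nu)=\sup_f\Big(\int f\,d\hat\mu-\int f\,d\hat\nu\Big)$$ if $\hat\mu,\hat\nu$ are finite, the supremum being over all continuous $f$ with $|f|\le1$ and $|f(z)-f(w)|\le|z-w|^{\varepsilon\wedge1}$; for all other pairs put $d^\varepsilon_{\mathcal L}(\mu,\nu)=\infty$ if $\mu\ne\nu$, and $0$ if $\mu=\nu$. The set $\mathbb R^d\times\mathbb S^d_+\times\mathcal L$ carries the (generalized) maximum metric of its three factors, with its topology and Borel sets. Let $\mathcal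 C\subset\mathbb R^d\times\mathbb S^d_+\times\mathcal L$ be compact, and for each $t\in[0,T]$ let $\Theta_t\subseteq\mathcal C$ be nonempty, closed and convex, such that: * $t\mapsto\Theta_t$ is weakly measurable: $\{t\in[0,T]:\Theta_t\cap G\neq\varnothing\}$ is Borel for every open $G$; * for each $t$ the set $\mathbf S_t=\bigcup_{(y,M,\mu)\in\Theta_t}\operatorname{supp}\mu$ is closed, and there is $\kappa_t>0$ with $\{|z|\le\kappa_t^{-1}\}\subseteq\operatorname{Conv}(\mathbf S_t\cup\{0\})\subseteq\{|z|\le\kappa_t\}$ and $|y|\vee\|M\|_2\vee d^\varepsilon_{\mathcal L}(\mu,0)\le\kappa_t$ for all $(y,M,\mu)\in\Theta_t$; * $y^{\top}M^{-1}y\le2q_t(1-\log q_t)$ for all $t\in[0,T]$ and $(y,M,\mu)\in\Theta_t$. Let $\Theta$ also denote the set of Borel measurable $\theta$ on $[0,T]$ with $\theta_t\in\Theta_t$ for all $t$. Let $\mathfrak A_0$ be the set of all pairs $(\Pi,D)$ of Borel measurable functions $\Pi:[0,T]\to\mathbb R^d$, $D:[0,T]\to\mathbb R$. For $x\in\mathbb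 R^d$ and $(y,M,\mu)\in\Theta_t$ let $$h_t^{(y,M,\mu)}(x)=x^{\top}y-\tfrac12aq_t\,x^{\top}Mx+\int_{\mathbb R^d}\Big(\frac{e^{-aq_tx^{\top}z}}{-aq_t}+\frac1{aq_t}-x^{\top}z\Big)\mu(dz),$$ and for $(\Pi,D)\in\mathfrak A_0$, $\theta\in\Theta$ let $$H((\Pi,D),\theta)=\int_0^T\exp\Big(\int_0^t-aq_s\big(h_s^{\theta_s}(\Pi_s)-D_s\big)ds\Big)\Big(q_t\big(h_t^{\theta_t}(\Pi_t)-D_t\big)+U(D_t)\Big)dt,$$ with the convention $H((\Pi,D),\theta)=-\infty$ if $t\mapsto q_t(h_t^{\theta_t}(\Pi_t)-D_t)$ or the outer integrand is not Lebesgue integrable over $[0,T]$. **Theorem.** There exist $(\Pi^*,D^*)\in\mathfrak A_0$ and $\theta^*\in\Theta$ forming a saddle point of $H$, i.e. $$H((\Pi,D),\theta^*)\le H((\Pi^*,D^*),\theta^*)\le H((\Pi^*,D^*),\theta)\qquad\text{for all }(\Pi,D)\in\mathfrak A_0,\ \theta\in\Theta,$$ with the following properties. 1. For every $t\in[0,T]$,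 $(\Pi^*_t,\theta^*_t)$ is a saddle point of $h_t$ over $\mathbb R^d\times\Theta_t$: $h_t^{\theta^*_t}(x)\le h_t^{\theta^*_t}(\Pi^*_t)\le h_t^{p}(\Pi^*_t)$ for all $x\in\mathbb R^d$, $p\in\Theta_t$. 2. The function $s\mapsto h_s^{\theta^*_s}(\Pi^*_s)$ is integrable over $[0,T]$, and $D^*_t=q_t\int_t^Th_s^{\theta^*_s}(\Pi^*_s)\,ds$ for every $t\in[0,T]$. 3. All the maxima and minima below are attained, and $$\min_{\theta\in\Theta}\max_{(\Pi,D)\in\mathfrak A_0}H((\Pi,D),\theta)=\max_{(\Pi,D)\in\mathfrak A_0}\min_{\theta\in\Theta}H((\Pi,D),\theta)=H((\Pi^*,D^*),\theta^*)=\frac1a\Big(1-(T+1)\exp\Big(-\frac a{T+1}\int_0^Th_s^{\theta^*_s}(\Pi^*_s)\,ds\Big)\Big).$$ -/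

import Mathlib

open Set MeasureTheory
open scoped ENNReal NNReal

noncomputable section

/-! ### Lévy triplets and the generalized metric -/

/-- The measure `(|z|^(2-ε) ∧ 1).μ`, with density `|z|^(2-ε) ∧ 1` with respect to `μ`. -/
def weightedMeasure {d : ℕ} (ε : ℝ) (μ : Measure (EuclideanSpace ℝ (Fin d))) :
    Measure (EuclideanSpace ℝ (Fin d)) :=
  μ.withDensity fun z => ENNReal.ofReal (min (‖z‖ ^ (2 - ε)) 1)

/-- Continuous functions bounded by `1` that are `(ε ∧ 1)`-Hölder continuous with constant `1`. -/
def holderTestFunctions (d : ℕ) (ε : ℝ) : Set (EuclideanSpace ℝ (Fin d) → ℝ) :=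
  {f | Continuous f ∧ (∀ z, |f z| ≤ 1) ∧ ∀ z w, |f z - f w| ≤ ‖z - w‖ ^ (min ε 1)}

/-- The bounded-Hölder distance of two finite measures. -/
def boundedHolderEDist {d : ℕ} (ε : ℝ) (μ ν : Measure (EuclideanSpace ℝ (Fin d))) : ℝ≥0∞ :=
  ⨆ f ∈ holderTestFunctions d ε, ENNReal.ofReal (∫ z, f z ∂μ - ∫ z, f z ∂ν)

open Classical in
/-- The generalized metric on Lévy measures: the bounded-Hölder distance of the weighted measures,
when these are finite. Distinct measures are at distance `∞` if one of the weighted measures is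
infinite. -/
def levyEDist {d : ℕ} (ε : ℝ) (μ ν : Measure (EuclideanSpace ℝ (Fin d))) : ℝ≥0∞ :=
  if μ = ν then 0
  else if IsFiniteMeasure (weightedMeasure ε μ) ∧ IsFiniteMeasure (weightedMeasure ε ν) then
    boundedHolderEDist ε (weightedMeasure ε μ) (weightedMeasure ε ν)
  else ∞

/-- The `2`-norm (operator norm for the Euclidean norm) of a square matrix. -/
def matrixTwoNorm {d : ℕ} (M : Matrix (Fin d) (Fin d) ℝ) : ℝ :=
  ‖Matrix.toEuclideanCLM (n := Fin d) (𝕜 := ℝ) M‖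

/-- Lévy triplets `(y, M, μ)` on `ℝ^d`, with `M` symmetric positive definite and `μ` a Lévy measure.
The parameter `ε` only selects the generalized metric put on this set below. -/
@[ext]
structure LevyTriplet (d : ℕ) (ε : ℝ) where
  drift : EuclideanSpace ℝ (Fin d)
  cov : Matrix (Fin d) (Fin d) ℝ
  jump : Measure (EuclideanSpace ℝ (Fin d))
  cov_posDef : cov.PosDef
  jump_zero : jump {0} = 0
  jump_integrable : ∫⁻ z, ENNReal.ofReal (min (‖z‖ ^ 2) 1) ∂jump < ∞

/-- The underlying element of the product, in which convex combinations are taken. -/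
def LevyTriplet.toProd {d : ℕ} {ε : ℝ} (p : LevyTriplet d ε) :
    EuclideanSpace ℝ (Fin d) × Matrix (Fin d) (Fin d) ℝ × Measure (EuclideanSpace ℝ (Fin d)) :=
  (p.drift, p.cov, p.jump)

theorem boundedHolderEDist_comm_le {d : ℕ} (ε : ℝ)
    (μ ν : Measure (EuclideanSpace ℝ (Fin d))) :
    boundedHolderEDist ε μ ν ≤ boundedHolderEDist ε ν μ := by
  refine iSup₂_le fun f hf => ?_
  have hneg : (fun z => -f z) ∈ holderTestFunctions d ε := by
    refine ⟨hf.1.neg, fun z => by simpa using hf.2.1 z, fun z w => ?_⟩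
    have h := hf.2.2 z w
    rwa [show -f z - -f w = -(f z - f w) by ring, abs_neg]
  refine le_trans (le_of_eq ?_) (le_iSup₂ (f := fun (g : EuclideanSpace ℝ (Fin d) → ℝ)
    (_ : g ∈ holderTestFunctions d ε) => ENNReal.ofReal (∫ z, g z ∂ν - ∫ z, g z ∂μ))
    (fun z => -f z) hneg)
  simp only [integral_neg]
  congr 1
  ring

theorem levyEDist_comm {d : ℕ} (ε : ℝ) (μ ν : Measure (EuclideanSpace ℝ (Fin d))) :
    levyEDist ε μ ν = levyEDist ε ν μ := by
  by_cases h : μ = ν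
  · rw [h]
  · have h' : ν ≠ μ := fun e => h e.symm
    have hd := le_antisymm
      (boundedHolderEDist_comm_le ε (weightedMeasure ε μ) (weightedMeasure ε ν))
      (boundedHolderEDist_comm_le ε (weightedMeasure ε ν) (weightedMeasure ε μ))
    by_cases f : IsFiniteMeasure (weightedMeasure ε μ) ∧ IsFiniteMeasure (weightedMeasure ε ν)
    · rw [levyEDist, levyEDist, if_neg h, if_neg h', if_pos f, if_pos f.symm, hd]
    · rw [levyEDist, levyEDist, if_neg h, if_neg h', if_neg f, if_neg fun g => f g.symm]

theorem levyEDist_triangle {d : ℕ} (ε : ℝ) (μ ν ρ : Measure (EuclideanSpace ℝ (Fin d))) :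
    levyEDist ε μ ρ ≤ levyEDist ε μ ν + levyEDist ε ν ρ := by
  by_cases h1 : μ = ν
  · subst h1; simp [levyEDist]
  by_cases h2 : ν = ρ
  · subst h2; simp [levyEDist]
  by_cases h3 : μ = ρ
  · simp [levyEDist, h3]
  by_cases f1 : IsFiniteMeasure (weightedMeasure ε μ)
  · by_cases f2 : IsFiniteMeasure (weightedMeasure ε ν)
    · by_cases f3 : IsFiniteMeasure (weightedMeasure ε ρ)
      · simp only [levyEDist, h1, h2, h3, f1, f2, f3, and_self, if_true, if_false]
        refine iSup₂_le fun f hf => ?_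
        refine le_trans ?_ (add_le_add
          (le_iSup₂ (f := fun (g : EuclideanSpace ℝ (Fin d) → ℝ)
            (_ : g ∈ holderTestFunctions d ε) => ENNReal.ofReal
              (∫ z, g z ∂(weightedMeasure ε μ) - ∫ z, g z ∂(weightedMeasure ε ν))) f hf)
          (le_iSup₂ (f := fun (g : EuclideanSpace ℝ (Fin d) → ℝ)
            (_ : g ∈ holderTestFunctions d ε) => ENNReal.ofReal
              (∫ z, g z ∂(weightedMeasure ε ν) - ∫ z, g z ∂(weightedMeasure ε ρ))) f hf))
        refine le_trans (le_of_eq ?_) ENNReal.ofReal_add_le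
        congr 1
        ring
      · simp [levyEDist, h2, f3]
    · simp [levyEDist, h1, f2]
  · simp [levyEDist, h1, f1]

/-- The generalized maximum metric on Lévy triplets. -/
instance {d : ℕ} {ε : ℝ} : PseudoEMetricSpace (LevyTriplet d ε) where
  edist p r := max (edist p.drift r.drift)
    (max (ENNReal.ofReal (matrixTwoNorm (p.cov - r.cov))) (levyEDist ε p.jump r.jump))
  edist_self p := by simp [matrixTwoNorm, levyEDist]
  edist_comm p r := by
    rw [edist_comm p.drift, levyEDist_comm ε p.jump]
    congr 3
    rw [matrixTwoNorm, matrixTwoNorm, ← neg_sub, map_neg, norm_neg]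
  edist_triangle p r s := by
    refine max_le ?_ (max_le ?_ ?_)
    · exact (edist_triangle _ r.drift _).trans (add_le_add (le_max_left _ _) (le_max_left _ _))
    · refine le_trans ?_ (add_le_add ((le_max_left _ _).trans (le_max_right _ _))
        ((le_max_left _ _).trans (le_max_right _ _)))
      refine le_trans (ENNReal.ofReal_le_ofReal ?_) ENNReal.ofReal_add_le
      rw [matrixTwoNorm, ← sub_add_sub_cancel p.cov r.cov s.cov, map_add]
      exact norm_add_le _ _
    · exact (levyEDist_triangle ε _ r.jump _).trans
        (add_le_add ((le_max_right _ _).trans (le_max_right _ _))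
          ((le_max_right _ _).trans (le_max_right _ _)))

/-- Measurability of maps into the set of triplets refers to its Borel sets. -/
instance {d : ℕ} {ε : ℝ} : MeasurableSpace (LevyTriplet d ε) := borel _

instance {d : ℕ} {ε : ℝ} : BorelSpace (LevyTriplet d ε) := ⟨rfl⟩

/-! ### Correspondences of confidence sets

Functions of time are functions on `ℝ` of which only the values on `[0,T]` matter. -/

/-- `Θ` is weakly measurable on `[0,T]`: its lower inverse of every open set is Borel. -/
def WeaklyMeasurableOn {X : Type*} [TopologicalSpace X] (T : ℝ) (Θ : ℝ → Set X) : Prop :=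
  ∀ G : Set X, IsOpen G → MeasurableSet {t ∈ Icc 0 T | (Θ t ∩ G).Nonempty}

/-- The Borel measurable selectors of `Θ` on `[0,T]` (the possible PII triplets). -/
def selectors {d : ℕ} {ε : ℝ} (T : ℝ) (Θ : ℝ → Set (LevyTriplet d ε)) :
    Set (ℝ → LevyTriplet d ε) :=
  {θ | Measurable ((Icc 0 T).domRestrict θ) ∧ ∀ t ∈ Icc 0 T, θ t ∈ Θ t}

/-- The union of the supports of the Lévy measures in a set of triplets. -/
def jumpSupport {d : ℕ} {ε : ℝ} (S : Set (LevyTriplet d ε)) : Set (EuclideanSpace ℝ (Fin d)) :=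
  ⋃ p ∈ S, p.jump.support

/-- The set of jump sizes is closed, bounded and non-degenerate with a constant `κ`, which also
bounds the set of triplets. -/
def HasRegularJumps {d : ℕ} {ε : ℝ} (S : Set (LevyTriplet d ε)) : Prop :=
  IsClosed (jumpSupport S) ∧ ∃ κ : ℝ, 0 < κ ∧
    Metric.closedBall 0 κ⁻¹ ⊆ convexHull ℝ (jumpSupport S ∪ {0}) ∧
    convexHull ℝ (jumpSupport S ∪ {0}) ⊆ Metric.closedBall 0 κ ∧
    ∀ p ∈ S, ‖p.drift‖ ≤ κ ∧ matrixTwoNorm p.cov ≤ κ ∧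
      levyEDist ε p.jump 0 ≤ ENNReal.ofReal κ

/-! ### Kernels for the CARA utility -/

/-- The CARA utility `U(x) = e^{-ax} / (-a)`. -/
def caraUtility (a x : ℝ) : ℝ := 1 / (-a) * Real.exp (-a * x)

/-- `q_t = (T - t + 1)⁻¹`. -/
def consumptionScale (T t : ℝ) : ℝ := (T - t + 1)⁻¹

/-- The local kernel `h_t^{(y, M, μ)}(x)`. -/
def localKernel {d : ℕ} {ε : ℝ} (a T t : ℝ) (p : LevyTriplet d ε)
    (x : EuclideanSpace ℝ (Fin d)) : ℝ :=
  inner ℝ x p.drift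
    - 1 / 2 * a * consumptionScale T t * (x.ofLp ⬝ᵥ p.cov.mulVec x.ofLp)
    + ∫ z, (Real.exp (-a * consumptionScale T t * inner ℝ x z) / (-a * consumptionScale T t)
        + 1 / (a * consumptionScale T t) - inner ℝ x z) ∂p.jump

/-- The deterministic admissible policies `(Π, D)`: pairs of Borel measurable functions on
`[0,T]`. -/
def deterministicPolicies (d : ℕ) (T : ℝ) :
    Set ((ℝ → EuclideanSpace ℝ (Fin d)) × (ℝ → ℝ)) :=
  {ξ | Measurable ((Icc 0 T).domRestrict ξ.1) ∧ Measurable ((Icc 0 T).domRestrict ξ.2)}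

/-- `q_t (h_t^{θ_t}(Π_t) - D_t)`. -/
def kernelRate {d : ℕ} {ε : ℝ} (a T : ℝ)
    (ξ : (ℝ → EuclideanSpace ℝ (Fin d)) × (ℝ → ℝ)) (θ : ℝ → LevyTriplet d ε) (t : ℝ) : ℝ :=
  consumptionScale T t * (localKernel a T t (θ t) (ξ.1 t) - ξ.2 t)

/-- The integrand
`exp (∫_0^t -a q_s (h_s^{θ_s}(Π_s) - D_s) ds) (q_t (h_t^{θ_t}(Π_t) - D_t) + U(D_t))`. -/
def kernelIntegrand {d : ℕ} {ε : ℝ} (a T : ℝ)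
    (ξ : (ℝ → EuclideanSpace ℝ (Fin d)) × (ℝ → ℝ)) (θ : ℝ → LevyTriplet d ε) (t : ℝ) : ℝ :=
  Real.exp (∫ s in (0 : ℝ)..t, -a * kernelRate a T ξ θ s) *
    (kernelRate a T ξ θ t + caraUtility a (ξ.2 t))

open Classical in
/-- The global kernel `H((Π, D), θ)`. It is the iterated integral if the inner and the outer
integrand are Lebesgue integrable over `[0,T]`, and `-∞` otherwise. -/
def globalKernel {d : ℕ} {ε : ℝ} (a T : ℝ)
    (ξ : (ℝ → EuclideanSpace ℝ (Fin d)) × (ℝ → ℝ)) (θ : ℝ → LevyTriplet d ε) : EReal :=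
  if IntervalIntegrable (kernelRate a T ξ θ) volume 0 T ∧
      IntervalIntegrable (kernelIntegrand a T ξ θ) volume 0 T then
    ((∫ t in (0 : ℝ)..T, kernelIntegrand a T ξ θ t : ℝ) : EReal)
  else ⊥

/-! ### Attained minimax and maximin values -/

/-- `min_{x ∈ X} max_{y ∈ Y} f x y = v`, where all the maxima and the minimum are attained. -/
def IsMinMax {E F β : Type*} [Preorder β] (X : Set E) (Y : Set F) (f : E → F → β) (v : β) : Prop :=
  (∀ x ∈ X, ∃ m, IsGreatest (f x '' Y) m) ∧
    IsLeast {m | ∃ x ∈ X, IsGreatest (f x '' Y) m} v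

/-- `max_{y ∈ Y} min_{x ∈ X} f x y = v`, where all the minima and the maximum are attained. -/
def IsMaxMin {E F β : Type*} [Preorder β] (X : Set E) (Y : Set F) (f : E → F → β) (v : β) : Prop :=
  (∀ y ∈ Y, ∃ m, IsLeast ((fun x => f x y) '' X) m) ∧
    IsGreatest {m | ∃ y ∈ Y, IsLeast ((fun x => f x y) '' X) m} v

end

/-! The local problem is solved at each time separately, and the global kernel is monotone in the
local values.

Local problem. Up to the scale `a * consumptionScale T t`, the local kernel is the time-independent
`unitKernel` (`localKernel_eq`). It is affine in the triplet and, since the covariance is positive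
definite, strongly concave in the position, so its maximizer is unique and attracts every maximizing
sequence. Let `p` minimize the maximal kernel over the convex set `Θ t`. Perturbing `p` slightly
towards `q` and letting the perturbation vanish shows that `q` does no worse than `p` at the
maximizer of `p` (`unitKernel_saddle`); no general minimax theorem is needed. Minimizers are chosen
measurably in time by a Kuratowski–Ryll-Nardzewski argument. It rests on compactness and on the
joint continuity of the kernel in position and triplet, which holds once large jumps are cut off
(`continuousOn_cutoffKernel`).

Global problem. With `r = q (h - D)` and `R` its primitive, integrating the exact derivative gives
`H = (1/a) (1 - exp (-a R_T) - ∫ exp (-a (R + D)))` (`integral_kernel_eq`). This is increasing in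
`h` for fixed `D`. Integration by parts gives `∫ (R + D) + R_T = ∫ h`. Jensen's inequality, for
Lebesgue measure on `[0,T]` plus a unit atom at `T`, then bounds `H` by a function of `∫ h` alone
(`integral_kernel_le`). Equality holds when `R + D` is constant, which is what `excessConsumption`
achieves. Hence the best reply to any selector is the pointwise maximizer together with this
consumption. Against that policy, the local saddle inequality and monotonicity show that no selector
does better for the minimizer than the chosen one. -/

open Filter Topology

noncomputable section

/-! ### Measurable selection from compact-valued correspondences -/

section Selection

variable {ι X : Type*} [MeasurableSpace ι] [PseudoEMetricSpace X]

/-- A compact set meets a closed set as soon as it meets all its thickenings, because the distance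
to the closed set attains its minimum. Measurability thus passes from open to closed test sets. -/
theorem measurableSet_nonempty_inter_of_isClosed {S : ι → Set X} (hc : ∀ t, IsCompact (S t))
    (hm : ∀ G, IsOpen G → MeasurableSet {t | (S t ∩ G).Nonempty}) {F : Set X}
    (hF : IsClosed F) : MeasurableSet {t | (S t ∩ F).Nonempty} := by
  have key : {t | (S t ∩ F).Nonempty} =
      ⋂ n : ℕ, {t | (S t ∩ Metric.thickening (1 / ((n : ℝ) + 1)) F).Nonempty} := by
    ext t
    simp only [mem_ofPred_eq, mem_iInter]
    constructor
    · rintro ⟨x, hx, hxF⟩ n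
      exact ⟨x, hx, Metric.self_subset_thickening (by positivity) F hxF⟩
    · intro h
      obtain ⟨x, hx, -⟩ := h 0
      obtain ⟨x₀, hx₀, hmin⟩ := (hc t).exists_isMinOn ⟨x, hx⟩
        (Metric.continuous_infEDist (s := F)).continuousOn
      refine ⟨x₀, hx₀, ?_⟩
      rw [← hF.closure_eq, Metric.mem_closure_iff_infEDist_zero]
      have hle : ∀ n : ℕ, Metric.infEDist x₀ F ≤ ENNReal.ofReal (1 / ((n : ℝ) + 1)) := by
        intro n
        obtain ⟨y, hy, hyF⟩ := h n
        exact (hmin hy).trans (Metric.mem_thickening_iff_infEDist_lt.1 hyF).le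
      have hlim : Tendsto (fun n : ℕ => ENNReal.ofReal (1 / ((n : ℝ) + 1))) atTop (𝓝 0) := by
        simpa using ENNReal.tendsto_ofReal (tendsto_one_div_add_atTop_nhds_zero_nat (𝕜 := ℝ))
      exact le_antisymm (ge_of_tendsto' hlim hle) bot_le
  rw [key]
  exact MeasurableSet.iInter fun n => hm _ Metric.isOpen_thickening

/-- One step of the selection: intersect with the first ball of radius `δ`, centred in a countable
dense family, that is met. The first index is measurable, so the refined correspondence is again
measurable, being a countable union over its values. Testing with closed sets lets the closed ball
be absorbed into the test set. -/
theorem exists_measurable_refinement [MeasurableSpace X] [BorelSpace X] {c : ℕ → X}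
    {C : Set X} (hCc : C ⊆ closure (range c)) {S : ι → Set X} (hSC : ∀ t, S t ⊆ C)
    (hne : ∀ t, (S t).Nonempty) (hcl : ∀ t, IsClosed (S t))
    (hm : ∀ F, IsClosed F → MeasurableSet {t | (S t ∩ F).Nonempty}) {δ : ℝ≥0∞} (hδ : 0 < δ) :
    ∃ (f : ι → X) (S' : ι → Set X), Measurable f ∧ (∀ t, S' t ⊆ S t) ∧
      (∀ t, ∀ x ∈ S' t, edist x (f t) ≤ δ) ∧ (∀ t, (S' t).Nonempty) ∧ (∀ t, IsClosed (S' t)) ∧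
      ∀ F, IsClosed F → MeasurableSet {t | (S' t ∩ F).Nonempty} := by
  classical
  have hex : ∀ t, ∃ k, (S t ∩ Metric.closedEBall (c k) δ).Nonempty := by
    intro t
    obtain ⟨x, hx⟩ := hne t
    obtain ⟨_, ⟨k, rfl⟩, hk⟩ := EMetric.mem_closure_iff.1 (hCc (hSC t hx)) δ hδ
    exact ⟨k, x, hx, hk.le⟩
  have hk : Measurable fun t => Nat.find (hex t) :=
    measurable_find hex fun k => hm _ Metric.isClosed_closedEBall
  refine ⟨fun t => c (Nat.find (hex t)),
    fun t => S t ∩ Metric.closedEBall (c (Nat.find (hex t))) δ,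
    (measurable_from_top (f := c)).comp hk, fun t => inter_subset_left, fun t x hx => hx.2,
    fun t => Nat.find_spec (hex t), fun t => (hcl t).inter Metric.isClosed_closedEBall, ?_⟩
  intro F hF
  have : {t | (S t ∩ Metric.closedEBall (c (Nat.find (hex t))) δ ∩ F).Nonempty} =
      ⋃ j : ℕ, ((fun t => Nat.find (hex t)) ⁻¹' {j}) ∩
        {t | (S t ∩ (Metric.closedEBall (c j) δ ∩ F)).Nonempty} := by
    ext t
    simp [inter_assoc]
  rw [this]
  exact MeasurableSet.iUnion fun j => (hk (measurableSet_singleton j)).inter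
    (hm _ (Metric.isClosed_closedEBall.inter hF))

/-- Kuratowski–Ryll-Nardzewski selection for compact-valued correspondences. -/
theorem exists_measurable_selection [MeasurableSpace X] [BorelSpace X] {C : Set X}
    (hC : IsCompact C) {S : ι → Set X} (hSC : ∀ t, S t ⊆ C) (hne : ∀ t, (S t).Nonempty)
    (hcl : ∀ t, IsClosed (S t))
    (hm : ∀ F, IsClosed F → MeasurableSet {t | (S t ∩ F).Nonempty}) :
    ∃ g : ι → X, Measurable g ∧ ∀ t, g t ∈ S t := by
  rcases isEmpty_or_nonempty ι with hι | ⟨⟨t₀⟩⟩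
  · exact ⟨fun t => hι.elim t, measurable_of_empty _, fun t => hι.elim t⟩
  have : Nonempty X := ⟨(hne t₀).some⟩
  obtain ⟨D, hDc, hCD⟩ := hC.isSeparable
  obtain ⟨c, hc⟩ : ∃ c : ℕ → X, D ⊆ range c := countable_iff_exists_subset_range.mp hDc
  have hCc : C ⊆ closure (range c) := hCD.trans (closure_mono hc)
  let Good : Type _ := {B : ι → Set X // (∀ t, B t ⊆ C) ∧ (∀ t, (B t).Nonempty) ∧
    (∀ t, IsClosed (B t)) ∧ ∀ F, IsClosed F → MeasurableSet {t | (B t ∩ F).Nonempty}}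
  have step : ∀ (n : ℕ) (B : Good), ∃ (B' : Good) (f : ι → X), Measurable f ∧
      (∀ t, B'.1 t ⊆ B.1 t) ∧ ∀ t, ∀ x ∈ B'.1 t, edist x (f t) ≤ (n + 1 : ℝ≥0∞)⁻¹ := by
    intro n B
    obtain ⟨f, S', hf, hsub, hd, hne', hcl', hm'⟩ := exists_measurable_refinement hCc B.2.1
      B.2.2.1 B.2.2.2.1 B.2.2.2.2 (δ := (n + 1 : ℝ≥0∞)⁻¹) (by simp)
    exact ⟨⟨S', fun t => (hsub t).trans (B.2.1 t), hne', hcl', hm'⟩, f, hf, hsub, hd⟩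
  choose next f hf hsub hd using step
  let A : ℕ → Good := fun n => Nat.rec ⟨S, hSC, hne, hcl, hm⟩ (fun n B => next n B) n
  -- Compactness replaces completeness: `g` is an arbitrary choice from the nested intersection, and
  -- it is measurable because it lies within `1/(n+1)` of the measurable `f n (A n)`.
  have hA : ∀ t, (⋂ n, (A n).1 t).Nonempty := fun t =>
    IsCompact.nonempty_iInter_of_sequence_nonempty_isCompact_isClosed _
      (fun n => hsub n (A n) t) (fun n => (A n).2.2.1 t)
      (hC.of_isClosed_subset (hcl t) (hSC t)) (fun n => (A n).2.2.2.1 t)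
  choose g hg using hA
  simp only [mem_iInter] at hg
  refine ⟨g, measurable_of_tendsto_metrizable (f := fun n => f n (A n)) (fun n => hf n (A n)) ?_,
    fun t => hg t 0⟩
  rw [tendsto_pi_nhds]
  intro t
  rw [EMetric.tendsto_atTop]
  intro δ hδ
  obtain ⟨N, hN⟩ := ENNReal.exists_inv_nat_lt hδ.ne'
  refine ⟨N, fun n hn => ?_⟩
  rw [edist_comm]
  refine lt_of_le_of_lt (hd n (A n) t _ (hg t (n + 1))) (lt_of_le_of_lt ?_ hN)
  gcongr
  exact_mod_cast hn.trans (Nat.le_succ n)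

/-- Joint measurability of a weakly measurable correspondence and a measurable function. -/
theorem measurableSet_exists_mem_of_isOpen_prod {E : Type*} [TopologicalSpace E]
    [SecondCountableTopology E] [MeasurableSpace E] [OpensMeasurableSpace E] {S : ι → Set X}
    (hm : ∀ G, IsOpen G → MeasurableSet {t | (S t ∩ G).Nonempty}) {w : ι → E}
    (hw : Measurable w) {G : Set (E × X)} (hG : IsOpen G) :
    MeasurableSet {t | (({w t} ×ˢ S t) ∩ G).Nonempty} := by
  let B := TopologicalSpace.countableBasis E
  -- `V b` is the largest open set with `b ×ˢ V b ⊆ G`, so `G` is the countable union of these boxes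
  -- over basic `b`.
  let V : Set E → Set X := fun b => ⋃₀ {V | IsOpen V ∧ b ×ˢ V ⊆ G}
  have : {t | (({w t} ×ˢ S t) ∩ G).Nonempty} =
      ⋃ b ∈ B, (w ⁻¹' b) ∩ {t | (S t ∩ V b).Nonempty} := by
    ext t
    simp only [mem_ofPred_eq, mem_iUnion, mem_inter_iff, mem_preimage]
    constructor
    · rintro ⟨⟨u, p⟩, ⟨hu, hp⟩, hG'⟩
      obtain rfl : u = w t := hu
      obtain ⟨U, hU, V', hV', hUV⟩ := mem_nhds_prod_iff.1 (hG.mem_nhds hG')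
      obtain ⟨b, hb, hub, hbU⟩ := (TopologicalSpace.isBasis_countableBasis E).mem_nhds_iff.1 hU
      refine ⟨b, hb, hub, p, hp, interior V', ⟨isOpen_interior, ?_⟩, mem_interior_iff_mem_nhds.2 hV'⟩
      exact (Set.prod_mono hbU interior_subset).trans hUV
    · rintro ⟨b, -, hwb, p, hp, V', ⟨-, hV'⟩, hpV⟩
      exact ⟨(w t, p), ⟨rfl, hp⟩, hV' ⟨hwb, hpV⟩⟩
  rw [this]
  refine MeasurableSet.biUnion (TopologicalSpace.countable_countableBasis E) fun b hb => ?_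
  exact (hw (TopologicalSpace.isOpen_of_mem_countableBasis hb).measurableSet).inter
    (hm _ (isOpen_sUnion fun V hV => hV.1))

theorem measurableSet_exists_mem_of_isClosed_prod {E : Type*} [PseudoEMetricSpace E]
    [SecondCountableTopology E] [MeasurableSpace E] [OpensMeasurableSpace E] {S : ι → Set X}
    (hc : ∀ t, IsCompact (S t))
    (hm : ∀ G, IsOpen G → MeasurableSet {t | (S t ∩ G).Nonempty}) {w : ι → E}
    (hw : Measurable w) {F : Set (E × X)} (hF : IsClosed F) :
    MeasurableSet {t | ∃ p ∈ S t, (w t, p) ∈ F} := by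
  have := measurableSet_nonempty_inter_of_isClosed (S := fun t => {w t} ×ˢ S t)
    (fun t => isCompact_singleton.prod (hc t))
    (fun G hG => measurableSet_exists_mem_of_isOpen_prod hm hw hG) hF
  convert this using 3 with t
  constructor
  · rintro ⟨p, hp, hpF⟩
    exact ⟨(w t, p), ⟨rfl, hp⟩, hpF⟩
  · rintro ⟨⟨u, p⟩, ⟨hu, hp⟩, hpF⟩
    obtain rfl : u = w t := hu
    exact ⟨p, hp, hpF⟩

/-- Measurable selection of minimizers of a lower semicontinuous function. -/
theorem exists_measurable_argmin [MeasurableSpace X] [BorelSpace X] {C : Set X}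
    (hC : IsCompact C) {S : ι → Set X} (hSC : ∀ t, S t ⊆ C) (hne : ∀ t, (S t).Nonempty)
    {f : ι → X → ℝ}
    (hlsc : ∀ t r, IsClosed {p | p ∈ S t ∧ f t p ≤ r})
    (hm : ∀ F, IsClosed F → ∀ r, MeasurableSet {t | ∃ p ∈ S t, p ∈ F ∧ f t p ≤ r}) :
    ∃ g : ι → X, Measurable g ∧ ∀ t, g t ∈ S t ∧ ∀ p ∈ S t, f t (g t) ≤ f t p := by
  let L : ι → ℚ → Set X := fun t r => {p | p ∈ S t ∧ f t p ≤ r}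
  have hLmono : ∀ t, Monotone (L t) := fun t r s hrs p hp =>
    ⟨hp.1, hp.2.trans (Rat.cast_le.2 hrs)⟩
  have hLc : ∀ t r, IsCompact (L t r) := fun t r =>
    hC.of_isClosed_subset (hlsc t r) fun p hp => hSC t hp.1
  let A : ι → Set X := fun t => ⋂ r : {r : ℚ // (L t r).Nonempty}, L t r
  have hInd : ∀ t, Nonempty {r : ℚ // (L t r).Nonempty} := by
    intro t
    obtain ⟨p, hp⟩ := hne t
    obtain ⟨r, hr⟩ := exists_rat_gt (f t p)
    exact ⟨r, p, hp, hr.le⟩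
  -- The argmin set `A t` is the intersection of the nonempty rational sublevel sets. These form a
  -- chain of compact sets, so meeting `F` can be tested on each of them, which is a countable
  -- condition.
  have key : ∀ t F, IsClosed F →
      ((A t ∩ F).Nonempty ↔ ∀ r : ℚ, (L t r).Nonempty → (L t r ∩ F).Nonempty) := by
    intro t F hF
    constructor
    · rintro ⟨p, hp, hpF⟩ r hr
      exact ⟨p, mem_iInter.1 hp ⟨r, hr⟩, hpF⟩
    · intro h
      have := hInd t
      have hne' : (⋂ r : {r : ℚ // (L t r).Nonempty}, L t r ∩ F).Nonempty := by
        refine IsCompact.nonempty_iInter_of_directed_nonempty_isCompact_isClosed _ ?_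
          (fun r => h r r.2) (fun r => (hLc t r).inter_right hF) (fun r => (hlsc t r).inter hF)
        intro r s
        rcases le_total r.1 s.1 with hrs | hrs
        · exact ⟨r, Subset.rfl, inter_subset_inter_left _ (hLmono t hrs)⟩
        · exact ⟨s, inter_subset_inter_left _ (hLmono t hrs), Subset.rfl⟩
      obtain ⟨p, hp⟩ := hne'
      rw [mem_iInter] at hp
      exact ⟨p, mem_iInter.2 fun r => (hp r).1, (hp (Classical.arbitrary _)).2⟩
  have hAS : ∀ t, A t ⊆ S t := by
    intro t p hp
    have := hInd t
    exact (mem_iInter.1 hp (Classical.arbitrary _)).1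
  obtain ⟨g, hg, hgA⟩ := exists_measurable_selection hC (S := A) (fun t => (hAS t).trans (hSC t))
    (fun t => by simpa using (key t univ isClosed_univ).2 fun r hr => by simpa using hr)
    (fun t => isClosed_iInter fun r => hlsc t r)
    (fun F hF => by
      have : {t | (A t ∩ F).Nonempty} =
          ⋂ r : ℚ, {t | ∃ p ∈ S t, p ∈ univ ∧ f t p ≤ r}ᶜ ∪ {t | ∃ p ∈ S t, p ∈ F ∧ f t p ≤ r} := by
        ext t
        simp only [mem_ofPred_eq, key t F hF, mem_iInter, mem_union, mem_compl_iff,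
          ← imp_iff_not_or]
        refine forall_congr' fun r => ?_
        refine imp_congr ⟨fun ⟨p, hp⟩ => ⟨p, hp.1, trivial, hp.2⟩,
          fun ⟨p, h1, _, h2⟩ => ⟨p, h1, h2⟩⟩ ⟨fun ⟨p, hp, hF⟩ => ⟨p, hp.1, hF, hp.2⟩,
          fun ⟨p, h1, h, h2⟩ => ⟨p, ⟨h1, h2⟩, h⟩⟩
      rw [this]
      exact MeasurableSet.iInter fun r => (hm _ isClosed_univ r).compl.union (hm F hF r))
  refine ⟨g, hg, fun t => ⟨hAS t (hgA t), fun p hp => ?_⟩⟩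
  refine le_of_forall_gt_imp_ge_of_dense fun r hr => ?_
  obtain ⟨s, hps, hsr⟩ := exists_rat_btwn hr
  exact (mem_iInter.1 (hgA t) ⟨s, p, hp, hps.le⟩).2.trans hsr.le

end Selection

/-! ### Weak convergence from the bounded-Hölder metric -/

section WeakContinuity

variable {d : ℕ} {ε : ℝ}

/-- Uniform approximation of bounded uniformly continuous functions by Lipschitz functions,
through the infimal convolution with a multiple of the norm. -/
theorem exists_lipschitz_approx {E : Type*} [SeminormedAddCommGroup E] {φ : E → ℝ} {B : ℝ}
    (hB : ∀ z, |φ z| ≤ B) (hφ : UniformContinuous φ) {δ : ℝ} (hδ : 0 < δ) :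
    ∃ (ψ : E → ℝ) (K : ℝ), 0 ≤ K ∧ (∀ z, |ψ z| ≤ B) ∧ (∀ z w, |ψ z - ψ w| ≤ K * ‖z - w‖) ∧
      ∀ z, |φ z - ψ z| ≤ δ := by
  obtain ⟨η, hη, hφη⟩ := Metric.uniformContinuous_iff.1 hφ δ hδ
  have hB0 : 0 ≤ B := (abs_nonneg _).trans (hB 0)
  -- With this slope, a point `w` at distance at least `η` contributes at least `-B + 2 * B`, hence
  -- at least `φ z`, and cannot lower the infimum.
  set K := 2 * B / η with hK
  have hK0 : 0 ≤ K := by positivity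
  let ψ : E → ℝ := fun z => ⨅ w, (φ w + K * ‖z - w‖)
  have hbdd : ∀ z, BddBelow (range fun w => φ w + K * ‖z - w‖) := by
    refine fun z => ⟨-B, ?_⟩
    rintro _ ⟨w, rfl⟩
    have := (abs_le.1 (hB w)).1
    have : 0 ≤ K * ‖z - w‖ := by positivity
    simp only
    linarith
  have hle : ∀ z w, ψ z ≤ φ w + K * ‖z - w‖ := fun z w => ciInf_le (hbdd z) w
  have hle' : ∀ z, ψ z ≤ φ z := fun z => by simpa using hle z z
  have hge : ∀ z, φ z - δ ≤ ψ z := by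
    refine fun z => le_ciInf fun w => ?_
    rcases lt_or_ge ‖z - w‖ η with h | h
    · have h1 := hφη (a := z) (b := w) (by rwa [dist_eq_norm])
      rw [Real.dist_eq] at h1
      have h2 := (abs_lt.1 h1).2
      have : 0 ≤ K * ‖z - w‖ := by positivity
      linarith
    · have h1 : 2 * B ≤ K * ‖z - w‖ := by
        calc 2 * B = K * η := by rw [hK]; field_simp
          _ ≤ _ := by gcongr
      have h2 := (abs_le.1 (hB z)).2
      have h3 := (abs_le.1 (hB w)).1
      linarith
  have hlip : ∀ z w, ψ z - ψ w ≤ K * ‖z - w‖ := by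
    intro z w
    rw [sub_le_iff_le_add, ← sub_le_iff_le_add']
    refine le_ciInf fun x => ?_
    have h1 := hle z x
    have h2 : K * ‖z - x‖ ≤ K * ‖z - w‖ + K * ‖w - x‖ := by
      rw [← mul_add]
      gcongr
      exact norm_sub_le_norm_sub_add_norm_sub z w x
    linarith
  refine ⟨ψ, K, hK0, fun z => abs_le.2 ⟨?_, (hle' z).trans (abs_le.1 (hB z)).2⟩,
    fun z w => abs_le.2 ⟨?_, hlip z w⟩, fun z => abs_le.2 ⟨?_, ?_⟩⟩
  · refine le_ciInf fun w => ?_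
    have := (abs_le.1 (hB w)).1
    have : 0 ≤ K * ‖z - w‖ := by positivity
    linarith
  · have := hlip w z
    rw [norm_sub_rev] at this
    linarith
  · linarith [hle' z]
  · linarith [hge z]

/-- Below distance `1` the Lipschitz bound is stronger than the Hölder bound; above it the Hölder
bound is at least `1`, and the bound `c / 2` on `ψ` keeps the oscillation of `ψ / c` at most `1`. -/
theorem mem_holderTestFunctions_of_lipschitz (hε : 0 < ε) {ψ : EuclideanSpace ℝ (Fin d) → ℝ}
    {c : ℝ} (hc : 0 < c) (hb : ∀ z, |ψ z| ≤ c / 2) (hl : ∀ z w, |ψ z - ψ w| ≤ c * ‖z - w‖) :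
    (fun z => ψ z / c) ∈ holderTestFunctions d ε := by
  refine ⟨?_, fun z => ?_, fun z w => ?_⟩
  · refine Continuous.div_const ?_ c
    refine (LipschitzWith.of_dist_le_mul (K := ⟨c, hc.le⟩) fun z w => ?_).continuous
    rw [Real.dist_eq, dist_eq_norm]
    exact hl z w
  · rw [abs_div, abs_of_pos hc, div_le_one hc]
    linarith [hb z]
  · have hα : 0 < min ε 1 := lt_min hε one_pos
    rw [← sub_div, abs_div, abs_of_pos hc]
    rcases le_total ‖z - w‖ 1 with h | h
    · calc |ψ z - ψ w| / c ≤ c * ‖z - w‖ / c := by gcongr; exact hl z w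
        _ = ‖z - w‖ ^ (1 : ℝ) := by rw [Real.rpow_one]; field_simp
        _ ≤ ‖z - w‖ ^ (min ε 1) :=
          Real.rpow_le_rpow_of_exponent_ge' (norm_nonneg _) h hα.le (min_le_right _ _)
    · refine le_trans ?_ (Real.one_le_rpow h hα.le)
      rw [div_le_one hc]
      have := abs_sub (ψ z) (ψ w)
      linarith [hb z, hb w]

theorem integral_sub_le_of_levyEDist (hε : 0 < ε) {μ ν : Measure (EuclideanSpace ℝ (Fin d))}
    (hμ : IsFiniteMeasure (weightedMeasure ε μ)) (hν : IsFiniteMeasure (weightedMeasure ε ν))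
    {ψ : EuclideanSpace ℝ (Fin d) → ℝ} {c : ℝ} (hc : 0 < c) (hb : ∀ z, |ψ z| ≤ c / 2)
    (hl : ∀ z w, |ψ z - ψ w| ≤ c * ‖z - w‖) {r : ℝ} (hr : levyEDist ε μ ν < ENNReal.ofReal r) :
    |∫ z, ψ z ∂(weightedMeasure ε μ) - ∫ z, ψ z ∂(weightedMeasure ε ν)| ≤ c * r := by
  have hr0 : 0 < r := by
    by_contra h
    rw [ENNReal.ofReal_of_nonpos (not_lt.1 h)] at hr
    exact not_lt_bot hr
  have main : ∀ {μ ν : Measure (EuclideanSpace ℝ (Fin d))},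
      IsFiniteMeasure (weightedMeasure ε μ) → IsFiniteMeasure (weightedMeasure ε ν) →
      levyEDist ε μ ν < ENNReal.ofReal r →
      ∫ z, ψ z ∂(weightedMeasure ε μ) - ∫ z, ψ z ∂(weightedMeasure ε ν) ≤ c * r := by
    intro μ ν hμ hν hr
    by_cases h : μ = ν
    · rw [h, sub_self]; positivity
    rw [levyEDist, if_neg h, if_pos ⟨hμ, hν⟩] at hr
    have h1 := (le_iSup₂ (f := fun (g : EuclideanSpace ℝ (Fin d) → ℝ)
      (_ : g ∈ holderTestFunctions d ε) => ENNReal.ofReal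
        (∫ z, g z ∂(weightedMeasure ε μ) - ∫ z, g z ∂(weightedMeasure ε ν))) _
      (mem_holderTestFunctions_of_lipschitz hε hc hb hl)).trans_lt hr
    have h2 := ((ENNReal.ofReal_lt_ofReal_iff hr0).1 h1).le
    rw [integral_div, integral_div, ← sub_div, div_le_iff₀ hc] at h2
    linarith
  rw [abs_le]
  refine ⟨?_, main hμ hν hr⟩
  have := main hν hμ (by rwa [levyEDist_comm])
  linarith

/-- Measure and integrand vary together: `φ a` is replaced by `φ₀` uniformly, `φ₀` by a Lipschitz
`ψ`, and `ψ` is an admissible test function up to scaling. -/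
theorem tendsto_integral_weightedMeasure (hε : 0 < ε) {α : Type*} {l : Filter α}
    {μ : α → Measure (EuclideanSpace ℝ (Fin d))} {μ₀ : Measure (EuclideanSpace ℝ (Fin d))}
    (hμ : ∀ᶠ a in l, IsFiniteMeasure (weightedMeasure ε (μ a)))
    (hμ₀ : IsFiniteMeasure (weightedMeasure ε μ₀))
    (hlim : Tendsto (fun a => levyEDist ε (μ a) μ₀) l (𝓝 0))
    {φ : α → EuclideanSpace ℝ (Fin d) → ℝ} {φ₀ : EuclideanSpace ℝ (Fin d) → ℝ}
    (hφ : ∀ a, Continuous (φ a)) (hφ₀ : Continuous φ₀) (hs₀ : HasCompactSupport φ₀)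
    (hu : TendstoUniformly φ φ₀ l) :
    Tendsto (fun a => ∫ z, φ a z ∂(weightedMeasure ε (μ a))) l
      (𝓝 (∫ z, φ₀ z ∂(weightedMeasure ε μ₀))) := by
  obtain ⟨B, hB⟩ : ∃ B, ∀ z, |φ₀ z| ≤ B := by
    obtain ⟨B, hB⟩ := hφ₀.bounded_above_of_compact_support hs₀
    exact ⟨B, hB⟩
  have hB0 : 0 ≤ B := (abs_nonneg _).trans (hB 0)
  have hunif := hs₀.uniformContinuous_of_continuous hφ₀
  set m := (weightedMeasure ε μ₀).real univ with hm
  have hm0 : 0 ≤ m := measureReal_nonneg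
  rw [Metric.tendsto_nhds]
  intro δ hδ
  -- The three errors are `2 * δ' * (m + 1)`, `δ'` and `δ' * m`, in total `δ' * (3 * m + 3)`, which
  -- is less than `δ`.
  set δ' := δ / (3 * m + 4) with hδ'
  have hδ'0 : 0 < δ' := by positivity
  obtain ⟨ψ, K, hK, hψB, hψl, hψ⟩ := exists_lipschitz_approx hB hunif hδ'0
  have hψc : Continuous ψ := by
    refine (LipschitzWith.of_dist_le_mul (K := ⟨K, hK⟩) fun z w => ?_).continuous
    rw [Real.dist_eq, dist_eq_norm]
    exact hψl z w
  set c := K + 2 * B + 1 with hc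
  have hc0 : 0 < c := by positivity
  have ev1 : ∀ᶠ a in l, levyEDist ε (μ a) μ₀ < ENNReal.ofReal (δ' / c) :=
    hlim.eventually_lt_const (by simp; positivity)
  have ev2 : ∀ᶠ a in l, levyEDist ε (μ a) μ₀ < ENNReal.ofReal (1 / 2) :=
    hlim.eventually_lt_const (by simp)
  filter_upwards [hμ, ev1, ev2, Metric.tendstoUniformly_iff.1 hu δ' hδ'0] with a ha h1 h2 h3
  -- Testing with the constant `1` controls the total masses; `c = 2` and distance below `1 / 2`
  -- give the margin `1`.
  have hmass : (weightedMeasure ε (μ a)).real univ ≤ m + 1 := by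
    have := integral_sub_le_of_levyEDist hε ha hμ₀ (ψ := fun _ => 1) (c := 2) (by norm_num)
      (by simp) (fun z w => by simp) h2
    simp only [integral_const, smul_eq_mul, mul_one] at this
    linarith [(abs_le.1 this).2]
  have hψ1 : |∫ z, ψ z ∂(weightedMeasure ε (μ a)) - ∫ z, ψ z ∂(weightedMeasure ε μ₀)| ≤ δ' := by
    have := integral_sub_le_of_levyEDist hε ha hμ₀ hc0
      (fun z => (hψB z).trans (by rw [hc]; linarith))
      (fun z w => (hψl z w).trans (by gcongr; rw [hc]; linarith)) h1
    rwa [mul_div_cancel₀ _ hc0.ne'] at this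
  have hdiff : ∀ (ν : Measure (EuclideanSpace ℝ (Fin d))), IsFiniteMeasure ν →
      ∀ (f : EuclideanSpace ℝ (Fin d) → ℝ), Continuous f → ∀ r, (∀ z, |f z - ψ z| ≤ r) →
      |∫ z, f z ∂ν - ∫ z, ψ z ∂ν| ≤ r * ν.real univ := by
    intro ν hν f hf r hr
    have hiψ : Integrable ψ ν := Integrable.of_bound hψc.aestronglyMeasurable B
      (Eventually.of_forall hψB)
    have hid : Integrable (fun z => f z - ψ z) ν :=
      Integrable.of_bound (hf.sub hψc).aestronglyMeasurable r (Eventually.of_forall hr)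
    have hif : Integrable f ν := (hid.add hiψ).congr (Eventually.of_forall fun z => by simp)
    rw [← integral_sub hif hiψ]
    exact norm_integral_le_of_norm_le_const (f := fun z => f z - ψ z) (Eventually.of_forall hr)
  have e1 := hdiff _ ha (φ a) (hφ a) (2 * δ') (fun z => by
    have h4 := h3 z
    rw [dist_comm, Real.dist_eq] at h4
    have h5 := hψ z
    calc |φ a z - ψ z| = |(φ a z - φ₀ z) + (φ₀ z - ψ z)| := by ring_nf
      _ ≤ |φ a z - φ₀ z| + |φ₀ z - ψ z| := abs_add_le _ _
      _ ≤ _ := by linarith)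
  have e2 := hdiff _ hμ₀ φ₀ hφ₀ δ' hψ
  rw [Real.dist_eq]
  have e3 : 2 * δ' * (weightedMeasure ε (μ a)).real univ ≤ 2 * δ' * (m + 1) := by gcongr
  have e4 : δ = δ' * (3 * m + 4) := by rw [hδ']; field_simp
  rw [abs_le] at e1 e2 hψ1
  rw [abs_lt]
  constructor <;> nlinarith [e1.1, e1.2, e2.1, e2.2, hψ1.1, hψ1.2]

end WeakContinuity

/-! ### The scalar jump integrand -/

section JumpFunction

/-- The scalar function `1 - e^{-s} - s` that is integrated against the jump measure. -/
def jumpFunction (s : ℝ) : ℝ := 1 - Real.exp (-s) - s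

theorem continuous_jumpFunction : Continuous jumpFunction := by
  unfold jumpFunction; fun_prop

theorem jumpFunction_zero : jumpFunction 0 = 0 := by simp [jumpFunction]

theorem jumpFunction_nonpos (s : ℝ) : jumpFunction s ≤ 0 := by
  have := Real.add_one_le_exp (-s)
  unfold jumpFunction
  linarith

/-- The arithmetic-geometric mean inequality for `exp (-s)` and `exp (-t)`. -/
theorem jumpFunction_midpoint (s t : ℝ) :
    (jumpFunction s + jumpFunction t) / 2 ≤ jumpFunction ((s + t) / 2) := by
  have h : Real.exp (-((s + t) / 2)) ^ 2 = Real.exp (-s) * Real.exp (-t) := by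
    rw [← Real.exp_nat_mul, ← Real.exp_add]; congr 1; push_cast; ring
  have h1 : Real.exp (-s) = Real.exp (-s / 2) ^ 2 := by
    rw [← Real.exp_nat_mul]; congr 1; push_cast; ring
  have h2 : Real.exp (-t) = Real.exp (-t / 2) ^ 2 := by
    rw [← Real.exp_nat_mul]; congr 1; push_cast; ring
  have h3 : Real.exp (-((s + t) / 2)) = Real.exp (-s / 2) * Real.exp (-t / 2) := by
    rw [← Real.exp_add]; congr 1; ring
  unfold jumpFunction
  rw [h1, h2, h3]
  nlinarith [sq_nonneg (Real.exp (-s / 2) - Real.exp (-t / 2))]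

theorem abs_exp_sub_one_le_mul_exp (x : ℝ) : |Real.exp x - 1| ≤ |x| * Real.exp |x| := by
  rcases le_total 0 x with h | h
  · rw [abs_of_nonneg h, abs_of_nonneg (by linarith [Real.add_one_le_exp x])]
    have h1 := Real.add_one_le_exp (-x)
    have h2 : Real.exp (-x) * Real.exp x = 1 := by rw [← Real.exp_add]; simp
    nlinarith [Real.exp_pos x]
  · rw [abs_of_nonpos h, abs_of_nonpos (by linarith [Real.exp_le_one_iff.2 h])]
    have h1 := Real.add_one_le_exp x
    have h2 : 1 ≤ Real.exp (-x) := Real.one_le_exp (by linarith)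
    nlinarith

theorem abs_jumpFunction_sub_le {s t R : ℝ} (hs : |s| ≤ R) (ht : |t| ≤ R) :
    |jumpFunction s - jumpFunction t| ≤ R * Real.exp R * |s - t| := by
  have hd : ∀ x, HasDerivAt jumpFunction (Real.exp (-x) - 1) x := by
    intro x
    have := (((hasDerivAt_id x).neg.exp).const_sub 1).sub (hasDerivAt_id x)
    refine HasDerivAt.congr_deriv (f := jumpFunction) this ?_
    simp
  have := (convex_Icc (-R) R).norm_image_sub_le_of_norm_hasDerivWithin_le (f := jumpFunction)
    (f' := fun x => Real.exp (-x) - 1) (C := R * Real.exp R)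
    (fun x _ => (hd x).hasDerivWithinAt) (fun x hx => ?_) (abs_le.1 ht) (abs_le.1 hs)
  · simpa only [Real.norm_eq_abs] using this
  · have hx' := abs_le.2 hx
    have := abs_exp_sub_one_le_mul_exp (-x)
    rw [abs_neg] at this
    rw [Real.norm_eq_abs]
    refine this.trans ?_
    have := (abs_nonneg x).trans hx'
    gcongr

variable {E : Type*} [NormedAddCommGroup E] [InnerProductSpace ℝ E]

/-- The derivative of `jumpFunction` vanishes at `0`, so its Lipschitz constant on `[-R, R]` carries
a factor `R`. This supplies one factor `‖z‖`; the inner product supplies the other. -/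
theorem abs_jumpFunction_inner_sub_le {u v z : E} {ρ : ℝ} (hu : ‖u‖ ≤ ρ) (hv : ‖v‖ ≤ ρ) :
    |jumpFunction (inner ℝ u z) - jumpFunction (inner ℝ v z)| ≤
      ρ * Real.exp (ρ * ‖z‖) * ‖u - v‖ * ‖z‖ ^ 2 := by
  have h1 : |inner ℝ u z| ≤ ρ * ‖z‖ := (abs_real_inner_le_norm u z).trans (by gcongr)
  have h2 : |inner ℝ v z| ≤ ρ * ‖z‖ := (abs_real_inner_le_norm v z).trans (by gcongr)
  refine (abs_jumpFunction_sub_le h1 h2).trans ?_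
  rw [← inner_sub_left]
  have := abs_real_inner_le_norm (u - v) z
  have hρ := (norm_nonneg u).trans hu
  calc ρ * ‖z‖ * Real.exp (ρ * ‖z‖) * |inner ℝ (u - v) z|
      ≤ ρ * ‖z‖ * Real.exp (ρ * ‖z‖) * (‖u - v‖ * ‖z‖) := by gcongr
    _ = _ := by ring

theorem abs_jumpFunction_inner_le (u z : E) :
    |jumpFunction (inner ℝ u z)| ≤ ‖u‖ ^ 2 * Real.exp (‖u‖ * ‖z‖) * ‖z‖ ^ 2 := by
  have := abs_jumpFunction_inner_sub_le (z := z) (le_refl ‖u‖) (v := 0) (by simp)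
  simp only [inner_zero_left, jumpFunction_zero, sub_zero] at this
  refine this.trans (le_of_eq ?_)
  ring

end JumpFunction

/-! ### Truncated jump integrand relative to the weight -/

section CutOff

variable {d : ℕ} {ε : ℝ}

/-- The density `|z|^(2-ε) ∧ 1`. -/
def jumpWeight (ε : ℝ) {d : ℕ} (z : EuclideanSpace ℝ (Fin d)) : ℝ := min (‖z‖ ^ (2 - ε)) 1

theorem continuous_jumpWeight (hε2 : ε ≤ 2) : Continuous (jumpWeight ε (d := d)) :=
  (continuous_norm.rpow_const fun _ => Or.inr (by linarith)).min continuous_const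

theorem jumpWeight_nonneg (z : EuclideanSpace ℝ (Fin d)) : 0 ≤ jumpWeight ε z :=
  le_min (by positivity) zero_le_one

theorem jumpWeight_pos {z : EuclideanSpace ℝ (Fin d)} (hz : z ≠ 0) : 0 < jumpWeight ε z :=
  lt_min (Real.rpow_pos_of_pos (norm_pos_iff.2 hz) _) one_pos

theorem sq_norm_le_mul_jumpWeight (hε : 0 < ε) (hε2 : ε ≤ 2) {R : ℝ} (hR : 1 ≤ R)
    {z : EuclideanSpace ℝ (Fin d)} (hz : ‖z‖ ≤ R) : ‖z‖ ^ 2 ≤ R ^ 2 * jumpWeight ε z := by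
  by_cases hz0 : z = 0
  · subst hz0
    simp only [norm_zero]
    have := jumpWeight_nonneg (ε := ε) (0 : EuclideanSpace ℝ (Fin d))
    rw [zero_pow two_ne_zero]
    positivity
  have hz1 := norm_pos_iff.2 hz0
  rw [jumpWeight, mul_min_of_nonneg _ _ (by positivity), le_min_iff]
  constructor
  · rcases le_total ‖z‖ 1 with h | h
    · calc ‖z‖ ^ 2 = ‖z‖ ^ (2 : ℝ) := by norm_cast
        _ ≤ ‖z‖ ^ (2 - ε) := Real.rpow_le_rpow_of_exponent_ge hz1 h (by linarith)
        _ ≤ _ := le_mul_of_one_le_left (by positivity) (by nlinarith)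
    · calc ‖z‖ ^ 2 ≤ R ^ 2 * 1 := by rw [mul_one]; gcongr
        _ ≤ _ := by gcongr; exact Real.one_le_rpow h (by linarith)
  · rw [mul_one]; gcongr

/-- A continuous cutoff that is `1` on the ball of radius `n` and `0` outside that of radius
`n + 1`. -/
def ballCutoff (n : ℕ) {d : ℕ} (z : EuclideanSpace ℝ (Fin d)) : ℝ := max 0 (min 1 (n + 1 - ‖z‖))

theorem continuous_ballCutoff (n : ℕ) : Continuous (ballCutoff n (d := d)) := by
  unfold ballCutoff; fun_prop

theorem ballCutoff_nonneg (n : ℕ) (z : EuclideanSpace ℝ (Fin d)) : 0 ≤ ballCutoff n z :=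
  le_max_left _ _

theorem ballCutoff_le_one (n : ℕ) (z : EuclideanSpace ℝ (Fin d)) : ballCutoff n z ≤ 1 :=
  max_le zero_le_one (min_le_left _ _)

theorem ballCutoff_eq_one {n : ℕ} {z : EuclideanSpace ℝ (Fin d)} (hz : ‖z‖ ≤ n) :
    ballCutoff n z = 1 := by
  rw [ballCutoff, min_eq_left (by linarith), max_eq_right zero_le_one]

theorem ballCutoff_eq_zero {n : ℕ} {z : EuclideanSpace ℝ (Fin d)} (hz : (n : ℝ) + 1 ≤ ‖z‖) :
    ballCutoff n z = 0 :=
  max_eq_left ((min_le_right _ _).trans (by linarith))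

/-- The truncated jump integrand relative to the density `|z|^(2-ε) ∧ 1`. -/
def cutoffRatio (ε : ℝ) (n : ℕ) {d : ℕ} (u z : EuclideanSpace ℝ (Fin d)) : ℝ :=
  ballCutoff n z * jumpFunction (inner ℝ u z) / jumpWeight ε z

theorem jumpWeight_mul_cutoffRatio (n : ℕ) (u z : EuclideanSpace ℝ (Fin d)) :
    jumpWeight ε z * cutoffRatio ε n u z = ballCutoff n z * jumpFunction (inner ℝ u z) := by
  by_cases hz : z = 0
  · simp [cutoffRatio, hz, jumpFunction_zero]
  · rw [cutoffRatio, mul_div_cancel₀ _ (jumpWeight_pos hz).ne']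

theorem abs_cutoffRatio_sub_le (hε : 0 < ε) (hε2 : ε ≤ 2) (n : ℕ)
    {u v : EuclideanSpace ℝ (Fin d)} {ρ : ℝ} (hu : ‖u‖ ≤ ρ) (hv : ‖v‖ ≤ ρ)
    (z : EuclideanSpace ℝ (Fin d)) :
    |cutoffRatio ε n u z - cutoffRatio ε n v z| ≤
      ρ * Real.exp (ρ * (n + 1)) * (n + 1) ^ 2 * ‖u - v‖ := by
  have hρ := (norm_nonneg u).trans hu
  rw [cutoffRatio, cutoffRatio, ← sub_div, ← mul_sub]
  rcases lt_or_ge ((n : ℝ) + 1) ‖z‖ with h | h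
  · rw [ballCutoff_eq_zero h.le, zero_mul, zero_div, abs_zero]
    positivity
  by_cases hz : z = 0
  · simp only [hz, inner_zero_right, sub_self, mul_zero, zero_div, abs_zero]
    positivity
  have hw := jumpWeight_pos (ε := ε) hz
  rw [abs_div, abs_mul, abs_of_nonneg (ballCutoff_nonneg _ _), abs_of_pos hw, div_le_iff₀ hw]
  have hsq := sq_norm_le_mul_jumpWeight hε hε2 (R := n + 1) (by simp) h
  calc ballCutoff n z * |jumpFunction (inner ℝ u z) - jumpFunction (inner ℝ v z)|
      ≤ 1 * (ρ * Real.exp (ρ * ‖z‖) * ‖u - v‖ * ‖z‖ ^ 2) := by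
        gcongr
        · exact ballCutoff_le_one n z
        · exact abs_jumpFunction_inner_sub_le hu hv
    _ ≤ 1 * (ρ * Real.exp (ρ * (n + 1)) * ‖u - v‖ * ((n + 1) ^ 2 * jumpWeight ε z)) := by
        gcongr
    _ = _ := by ring

/-- Only the origin matters: there the numerator is `O(‖z‖ ^ 2)` and the weight is `‖z‖ ^ (2 - ε)`,
so the ratio is `O(‖z‖ ^ ε)` and tends to its value `0`. -/
theorem continuous_cutoffRatio (hε : 0 < ε) (hε2 : ε ≤ 2) (n : ℕ)
    (u : EuclideanSpace ℝ (Fin d)) : Continuous (cutoffRatio ε n u) := by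
  rw [continuous_iff_continuousAt]
  intro z
  have hnum : Continuous fun z => ballCutoff n z * jumpFunction (inner ℝ u z) :=
    (continuous_ballCutoff n).mul (continuous_jumpFunction.comp (by fun_prop))
  by_cases hz : z = 0
  · subst hz
    have h0 : cutoffRatio ε n u 0 = 0 := by simp [cutoffRatio, jumpFunction_zero]
    rw [ContinuousAt, h0]
    have hlim : Tendsto (fun z : EuclideanSpace ℝ (Fin d) =>
        ‖u‖ ^ 2 * Real.exp ‖u‖ * ‖z‖ ^ ε) (𝓝 0) (𝓝 0) := by
      have : Continuous fun z : EuclideanSpace ℝ (Fin d) => ‖u‖ ^ 2 * Real.exp ‖u‖ * ‖z‖ ^ ε :=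
        continuous_const.mul (continuous_norm.rpow_const fun _ => Or.inr hε.le)
      simpa [Real.zero_rpow hε.ne'] using this.tendsto 0
    refine squeeze_zero_norm' ?_ hlim
    filter_upwards [Metric.closedBall_mem_nhds (0 : EuclideanSpace ℝ (Fin d)) one_pos] with z hz1
    rw [mem_closedBall_zero_iff] at hz1
    by_cases hz : z = 0
    · rw [hz, h0, norm_zero]
      positivity
    have hz0 := norm_pos_iff.2 hz
    have hw : jumpWeight ε z = ‖z‖ ^ (2 - ε) :=
      min_eq_left (Real.rpow_le_one (norm_nonneg _) hz1 (by linarith))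
    rw [Real.norm_eq_abs, cutoffRatio, hw, abs_div, abs_mul,
      abs_of_nonneg (ballCutoff_nonneg _ _), abs_of_pos (Real.rpow_pos_of_pos hz0 _),
      div_le_iff₀ (Real.rpow_pos_of_pos hz0 _), mul_assoc, ← Real.rpow_add hz0,
      add_sub_cancel, Real.rpow_two]
    calc ballCutoff n z * |jumpFunction (inner ℝ u z)|
        ≤ 1 * (‖u‖ ^ 2 * Real.exp (‖u‖ * ‖z‖) * ‖z‖ ^ 2) := by
          gcongr
          · exact ballCutoff_le_one n z
          · exact abs_jumpFunction_inner_le u z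
      _ ≤ 1 * (‖u‖ ^ 2 * Real.exp (‖u‖ * 1) * ‖z‖ ^ 2) := by gcongr
      _ = _ := by rw [one_mul, mul_one]
  · exact hnum.continuousAt.div (continuous_jumpWeight hε2).continuousAt (jumpWeight_pos hz).ne'

theorem hasCompactSupport_cutoffRatio (n : ℕ) (u : EuclideanSpace ℝ (Fin d)) :
    HasCompactSupport (cutoffRatio ε n u) := by
  refine HasCompactSupport.intro (isCompact_closedBall 0 ((n : ℝ) + 1)) fun z hz => ?_
  rw [mem_closedBall_zero_iff, not_le] at hz
  rw [cutoffRatio, ballCutoff_eq_zero hz.le, zero_mul, zero_div]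

theorem tendstoUniformly_cutoffRatio (hε : 0 < ε) (hε2 : ε ≤ 2) (n : ℕ)
    (u : EuclideanSpace ℝ (Fin d)) :
    TendstoUniformly (fun v => cutoffRatio ε n v) (cutoffRatio ε n u) (𝓝 u) := by
  rw [Metric.tendstoUniformly_iff]
  intro δ hδ
  set ρ := ‖u‖ + 1
  have hlim : Tendsto (fun v => ρ * Real.exp (ρ * (n + 1)) * (n + 1) ^ 2 * ‖u - v‖) (𝓝 u)
      (𝓝 0) := by
    have : Continuous fun v => ρ * Real.exp (ρ * (n + 1)) * (n + 1) ^ 2 * ‖u - v‖ := by fun_prop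
    simpa using this.tendsto u
  filter_upwards [hlim.eventually_lt_const hδ, Metric.closedBall_mem_nhds u one_pos] with v hv hvu z
  rw [Real.dist_eq]
  refine (abs_cutoffRatio_sub_le hε hε2 n (by simp [ρ]) ?_ z).trans_lt hv
  rw [mem_closedBall_iff_norm'] at hvu
  have := norm_sub_norm_le v u
  rw [norm_sub_rev] at this
  simp only [ρ]
  linarith

theorem integral_cutoffRatio (hε2 : ε ≤ 2) (n : ℕ) (u : EuclideanSpace ℝ (Fin d))
    (μ : Measure (EuclideanSpace ℝ (Fin d))) :
    ∫ z, cutoffRatio ε n u z ∂(weightedMeasure ε μ) =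
      ∫ z, ballCutoff n z * jumpFunction (inner ℝ u z) ∂μ := by
  have hm : Measurable fun z : EuclideanSpace ℝ (Fin d) =>
      ENNReal.ofReal (min (‖z‖ ^ (2 - ε)) 1) :=
    (continuous_jumpWeight hε2).measurable.ennreal_ofReal
  rw [weightedMeasure, integral_withDensity_eq_integral_toReal_smul hm
    (Eventually.of_forall fun z => ENNReal.ofReal_lt_top)]
  refine integral_congr_ae (Eventually.of_forall fun z => ?_)
  change (ENNReal.ofReal (jumpWeight ε z)).toReal * _ = _
  rw [ENNReal.toReal_ofReal (jumpWeight_nonneg z)]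
  exact jumpWeight_mul_cutoffRatio n u z

end CutOff

/-! ### Joint continuity of the truncated kernel -/

section CutoffKernel

variable {d : ℕ} {ε : ℝ}

/-- Triplets of which the weighted jump measure is finite. -/
def finiteTriplets (d : ℕ) (ε : ℝ) : Set (LevyTriplet d ε) :=
  {p | IsFiniteMeasure (weightedMeasure ε p.jump)}

theorem LevyTriplet.levyEDist_le (p r : LevyTriplet d ε) :
    levyEDist ε p.jump r.jump ≤ edist p r :=
  (le_max_right _ _).trans (le_max_right _ _)

theorem LevyTriplet.continuous_drift : Continuous (LevyTriplet.drift (d := d) (ε := ε)) :=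
  (LipschitzWith.of_edist_le fun _ _ => le_max_left _ _).continuous

theorem LevyTriplet.continuous_cov : Continuous fun p : LevyTriplet d ε =>
    Matrix.toEuclideanCLM (n := Fin d) (𝕜 := ℝ) p.cov := by
  refine (LipschitzWith.of_edist_le fun p r => ?_).continuous
  rw [edist_eq_enorm_sub, ← map_sub, ← ofReal_norm]
  exact (le_max_left _ _).trans (le_max_right _ _)

theorem isFiniteMeasure_weightedMeasure_of_levyEDist {μ ν : Measure (EuclideanSpace ℝ (Fin d))}
    (hν : IsFiniteMeasure (weightedMeasure ε ν)) (h : levyEDist ε μ ν < ∞) :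
    IsFiniteMeasure (weightedMeasure ε μ) := by
  by_cases hμν : μ = ν
  · rwa [hμν]
  by_contra hμ
  rw [levyEDist, if_neg hμν, if_neg fun h => hμ h.1] at h
  exact lt_irrefl _ h

/-- Triplets at finite distance have both or neither of their weighted measures finite, so unit
balls around points of the complement stay in it. -/
theorem isClosed_finiteTriplets : IsClosed (finiteTriplets d ε) := by
  rw [← isOpen_compl_iff, EMetric.isOpen_iff]
  refine fun p hp => ⟨1, one_pos, fun r hr hr' => hp ?_⟩
  refine isFiniteMeasure_weightedMeasure_of_levyEDist hr' ?_
  rw [levyEDist_comm]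
  exact (r.levyEDist_le p).trans_lt (lt_trans hr (by simp))

/-- The local kernel at unit scale with truncated jumps. -/
def cutoffKernel (n : ℕ) (p : LevyTriplet d ε) (u : EuclideanSpace ℝ (Fin d)) : ℝ :=
  inner ℝ u p.drift - 1 / 2 * (u.ofLp ⬝ᵥ p.cov.mulVec u.ofLp)
    + ∫ z, ballCutoff n z * jumpFunction (inner ℝ u z) ∂p.jump

/-- Relative to the weighted measure, the truncated jump integrand is continuous with compact
support and depends on `u` uniformly in `z`; the metric on triplets controls exactly such integrals.
-/
theorem continuousOn_cutoffKernel (hε : 0 < ε) (hε2 : ε ≤ 2) (n : ℕ) :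
    ContinuousOn (fun x : EuclideanSpace ℝ (Fin d) × LevyTriplet d ε => cutoffKernel n x.2 x.1)
      (univ ×ˢ finiteTriplets d ε) := by
  unfold cutoffKernel
  refine ContinuousOn.add (Continuous.continuousOn ?_) ?_
  · refine Continuous.sub ?_ (continuous_const.mul ?_)
    · exact continuous_fst.inner (LevyTriplet.continuous_drift.comp continuous_snd)
    · simp_rw [← Matrix.inner_toEuclideanCLM]
      exact continuous_fst.inner
        ((LevyTriplet.continuous_cov.comp continuous_snd).clm_apply continuous_fst)
  · simp_rw [← integral_cutoffRatio hε2]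
    rintro ⟨u, p⟩ ⟨-, hp⟩
    have hsnd : Tendsto (fun x : EuclideanSpace ℝ (Fin d) × LevyTriplet d ε => x.2)
        (𝓝[univ ×ˢ finiteTriplets d ε] (u, p)) (𝓝 p) :=
      (continuous_snd.tendsto (u, p)).mono_left nhdsWithin_le_nhds
    have hfst : Tendsto (fun x : EuclideanSpace ℝ (Fin d) × LevyTriplet d ε => x.1)
        (𝓝[univ ×ˢ finiteTriplets d ε] (u, p)) (𝓝 u) :=
      (continuous_fst.tendsto (u, p)).mono_left nhdsWithin_le_nhds
    have hfin : ∀ᶠ x : EuclideanSpace ℝ (Fin d) × LevyTriplet d ε in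
        𝓝[univ ×ˢ finiteTriplets d ε] (u, p), IsFiniteMeasure (weightedMeasure ε x.2.jump) := by
      filter_upwards [self_mem_nhdsWithin] with x hx using hx.2
    have hlim : Tendsto (fun x : EuclideanSpace ℝ (Fin d) × LevyTriplet d ε =>
        levyEDist ε x.2.jump p.jump) (𝓝[univ ×ˢ finiteTriplets d ε] (u, p)) (𝓝 0) :=
      tendsto_of_tendsto_of_tendsto_of_le_of_le tendsto_const_nhds
        (tendsto_iff_edist_tendsto_0.1 hsnd) (fun _ => bot_le) fun x => x.2.levyEDist_le p
    have hunif : TendstoUniformly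
        (fun (x : EuclideanSpace ℝ (Fin d) × LevyTriplet d ε) => cutoffRatio ε n x.1)
        (cutoffRatio ε n u) (𝓝[univ ×ˢ finiteTriplets d ε] (u, p)) := by
      intro V hV
      exact hfst.eventually (p := fun v => ∀ z, (cutoffRatio ε n u z, cutoffRatio ε n v z) ∈ V)
        (tendstoUniformly_cutoffRatio hε hε2 n u V hV)
    exact tendsto_integral_weightedMeasure hε hfin hp hlim
      (fun x => continuous_cutoffRatio hε hε2 n x.1) (continuous_cutoffRatio hε hε2 n u)
      (hasCompactSupport_cutoffRatio n u) hunif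

attribute [irreducible] cutoffKernel

end CutoffKernel

/-! ### The unit kernel: strong concavity and its maximizer -/

section UnitKernel

variable {d : ℕ} {ε : ℝ}

/-- The local kernel at unit scale. -/
def unitKernel (p : LevyTriplet d ε) (u : EuclideanSpace ℝ (Fin d)) : ℝ :=
  inner ℝ u p.drift - 1 / 2 * (u.ofLp ⬝ᵥ p.cov.mulVec u.ofLp)
    + ∫ z, jumpFunction (inner ℝ u z) ∂p.jump

theorem unitKernel_zero (p : LevyTriplet d ε) : unitKernel p 0 = 0 := by
  simp [unitKernel, jumpFunction_zero]

/-- The local kernel is a rescaling of the time-independent kernel. -/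
theorem localKernel_eq {a T t : ℝ} (h : 0 < a * consumptionScale T t) (p : LevyTriplet d ε)
    (x : EuclideanSpace ℝ (Fin d)) :
    localKernel a T t p x = (a * consumptionScale T t)⁻¹ *
      unitKernel p ((a * consumptionScale T t) • x) := by
  have e : ∀ z : EuclideanSpace ℝ (Fin d),
      Real.exp (-a * consumptionScale T t * inner ℝ x z) / (-a * consumptionScale T t)
        + 1 / (a * consumptionScale T t) - inner ℝ x z =
      (a * consumptionScale T t)⁻¹ *
        jumpFunction (inner ℝ ((a * consumptionScale T t) • x) z) := by
    intro z
    have h1 : a ≠ 0 := (left_ne_zero_of_mul h.ne')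
    have h2 : consumptionScale T t ≠ 0 := (right_ne_zero_of_mul h.ne')
    rw [real_inner_smul_left, jumpFunction, ← neg_mul, ← neg_mul]
    field_simp
    ring
  simp only [localKernel, e]
  rw [integral_const_mul, unitKernel, real_inner_smul_left, WithLp.ofLp_smul, Matrix.mulVec_smul,
    smul_dotProduct, dotProduct_smul, smul_eq_mul, smul_eq_mul]
  set b := a * consumptionScale T t
  have : 1 / 2 * a * consumptionScale T t = 1 / 2 * b := by simp only [b]; ring
  rw [this]
  field_simp

/-- The jumps of `p` are bounded by `n`. -/
def LevyTriplet.JumpsIn (p : LevyTriplet d ε) (n : ℕ) : Prop :=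
  p.jump (Metric.closedBall 0 (n : ℝ))ᶜ = 0

theorem LevyTriplet.JumpsIn.mono {p : LevyTriplet d ε} {n m : ℕ} (h : p.JumpsIn n)
    (hnm : n ≤ m) : p.JumpsIn m := by
  refine measure_mono_null (compl_subset_compl.2 (Metric.closedBall_subset_closedBall ?_)) h
  exact_mod_cast hnm

theorem LevyTriplet.JumpsIn.ae {p : LevyTriplet d ε} {n : ℕ} (h : p.JumpsIn n) :
    ∀ᵐ z ∂p.jump, ‖z‖ ≤ n := by
  filter_upwards [compl_mem_ae_iff.2 h] with z hz
  simpa using hz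

theorem unitKernel_eq_cutoffKernel {p : LevyTriplet d ε} {n : ℕ} (h : p.JumpsIn n)
    (u : EuclideanSpace ℝ (Fin d)) : unitKernel p u = cutoffKernel n p u := by
  rw [unitKernel, cutoffKernel]
  congr 1
  refine integral_congr_ae ?_
  filter_upwards [h.ae] with z hz
  rw [ballCutoff_eq_one hz, one_mul]

theorem integrable_jumpFunction {p : LevyTriplet d ε} {n : ℕ} (h : p.JumpsIn n)
    (u : EuclideanSpace ℝ (Fin d)) :
    Integrable (fun z => jumpFunction (inner ℝ u z)) p.jump := by
  have hc : Continuous fun z : EuclideanSpace ℝ (Fin d) => min (‖z‖ ^ 2) 1 := by fun_prop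
  have hi : Integrable (fun z : EuclideanSpace ℝ (Fin d) => min (‖z‖ ^ 2) 1) p.jump := by
    refine ⟨hc.aestronglyMeasurable, ?_⟩
    rw [hasFiniteIntegral_iff_ofReal (Eventually.of_forall fun z => by positivity)]
    exact p.jump_integrable
  refine (hi.const_mul (‖u‖ ^ 2 * Real.exp (‖u‖ * n) * ((n : ℝ) + 1) ^ 2)).mono'
    (continuous_jumpFunction.comp (by fun_prop)).aestronglyMeasurable ?_
  filter_upwards [h.ae] with z hz
  have hsq : ‖z‖ ^ 2 ≤ ((n : ℝ) + 1) ^ 2 * min (‖z‖ ^ 2) 1 := by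
    rw [mul_min_of_nonneg _ _ (by positivity), le_min_iff]
    have : (0 : ℝ) ≤ n := n.cast_nonneg
    exact ⟨le_mul_of_one_le_left (by positivity) (by nlinarith), by rw [mul_one]; gcongr; linarith⟩
  calc ‖jumpFunction (inner ℝ u z)‖ ≤ ‖u‖ ^ 2 * Real.exp (‖u‖ * ‖z‖) * ‖z‖ ^ 2 :=
        abs_jumpFunction_inner_le u z
    _ ≤ ‖u‖ ^ 2 * Real.exp (‖u‖ * n) * (((n : ℝ) + 1) ^ 2 * min (‖z‖ ^ 2) 1) := by gcongr
    _ = _ := by ring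

/-- Triplets with finite weighted jump measure and bounded jumps. -/
def boundedTriplets (d : ℕ) (ε : ℝ) : Set (LevyTriplet d ε) :=
  {p | p ∈ finiteTriplets d ε ∧ ∃ n, p.JumpsIn n}

theorem continuous_unitKernel (hε : 0 < ε) (hε2 : ε ≤ 2) {p : LevyTriplet d ε}
    (hp : p ∈ boundedTriplets d ε) : Continuous (unitKernel p) := by
  obtain ⟨hf, n, hn⟩ := hp
  have : unitKernel p = fun u => cutoffKernel n p u :=
    funext fun u => unitKernel_eq_cutoffKernel hn u
  rw [this]
  exact (continuousOn_cutoffKernel hε hε2 n).comp_continuous (f := fun u => (u, p))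
    (by fun_prop) fun u => ⟨trivial, hf⟩

/-- The constant is the minimum of the quadratic form on the unit sphere, extended by homogeneity.
The sphere is empty when `d = 0`, which is treated apart. -/
theorem exists_forall_mul_sq_norm_le (p : LevyTriplet d ε) :
    ∃ c : ℝ, 0 < c ∧ ∀ u : EuclideanSpace ℝ (Fin d),
      c * ‖u‖ ^ 2 ≤ u.ofLp ⬝ᵥ p.cov.mulVec u.ofLp := by
  have hpos : ∀ u : EuclideanSpace ℝ (Fin d), u ≠ 0 → 0 < u.ofLp ⬝ᵥ p.cov.mulVec u.ofLp := by
    intro u hu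
    simpa using (Matrix.posDef_iff_dotProduct_mulVec.1 p.cov_posDef).2
      (x := u.ofLp) (by simpa using hu)
  have hcont : Continuous fun u : EuclideanSpace ℝ (Fin d) => u.ofLp ⬝ᵥ p.cov.mulVec u.ofLp := by
    simp_rw [← Matrix.inner_toEuclideanCLM]
    fun_prop
  rcases (Metric.sphere (0 : EuclideanSpace ℝ (Fin d)) 1).eq_empty_or_nonempty with h | h
  · refine ⟨1, one_pos, fun u => ?_⟩
    have hu : u = 0 := by
      by_contra hu
      have : (‖u‖⁻¹ • u) ∈ Metric.sphere (0 : EuclideanSpace ℝ (Fin d)) 1 := by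
        simp [norm_smul, hu]
      rw [h] at this
      exact this
    simp [hu]
  · obtain ⟨v, hv, hmin⟩ := (isCompact_sphere _ _).exists_isMinOn h hcont.continuousOn
    have hv0 : v ≠ 0 := by
      rintro rfl
      simp at hv
    refine ⟨_, hpos v hv0, fun u => ?_⟩
    by_cases hu : u = 0
    · simp [hu]
    have hn := norm_pos_iff.2 hu
    have := isMinOn_iff.1 hmin (‖u‖⁻¹ • u) (by simp [norm_smul, hu])
    simp only [WithLp.ofLp_smul, Matrix.mulVec_smul, smul_dotProduct, dotProduct_smul,
      smul_eq_mul] at this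
    calc _ ≤ (‖u‖⁻¹ * (‖u‖⁻¹ * (u.ofLp ⬝ᵥ p.cov.mulVec u.ofLp))) * ‖u‖ ^ 2 := by gcongr
      _ = _ := by field_simp

theorem LevyTriplet.dotProduct_cov_comm (p : LevyTriplet d ε) (x y : Fin d → ℝ) :
    x ⬝ᵥ p.cov.mulVec y = y ⬝ᵥ p.cov.mulVec x := by
  have h : p.cov.transpose = p.cov := by
    simpa [Matrix.IsHermitian, Matrix.conjTranspose_eq_transpose_of_trivial] using
      p.cov_posDef.isHermitian
  rw [Matrix.dotProduct_mulVec, ← Matrix.mulVec_transpose, h, dotProduct_comm]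

/-- Strong concavity: the parallelogram identity for the covariance form leaves one eighth of its
value at `u - v`, the drift term is linear, and the jump term is midpoint concave. -/
theorem exists_unitKernel_midpoint {p : LevyTriplet d ε} (hp : p ∈ boundedTriplets d ε) :
    ∃ c : ℝ, 0 < c ∧ ∀ u v, (unitKernel p u + unitKernel p v) / 2 + c * ‖u - v‖ ^ 2 ≤
      unitKernel p ((1 / 2 : ℝ) • (u + v)) := by
  obtain ⟨c, hc, hcu⟩ := exists_forall_mul_sq_norm_le p
  obtain ⟨-, n, hn⟩ := hp
  refine ⟨c / 8, by positivity, fun u v => ?_⟩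
  have hJ : (∫ z, jumpFunction (inner ℝ u z) ∂p.jump + ∫ z, jumpFunction (inner ℝ v z) ∂p.jump) / 2
      ≤ ∫ z, jumpFunction (inner ℝ ((1 / 2 : ℝ) • (u + v)) z) ∂p.jump := by
    rw [← integral_add (integrable_jumpFunction hn u) (integrable_jumpFunction hn v),
      ← integral_div]
    refine integral_mono (((integrable_jumpFunction hn u).add
      (integrable_jumpFunction hn v)).div_const 2) (integrable_jumpFunction hn _) fun z => ?_
    have := jumpFunction_midpoint (inner ℝ u z) (inner ℝ v z)
    refine this.trans (le_of_eq ?_)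
    rw [real_inner_smul_left, inner_add_left]
    congr 1
    ring
  have hq := hcu (u - v)
  have hcomm := p.dotProduct_cov_comm u.ofLp v.ofLp
  simp only [unitKernel, real_inner_smul_left, inner_add_left, WithLp.ofLp_smul, WithLp.ofLp_add,
    WithLp.ofLp_sub, Matrix.mulVec_smul, Matrix.mulVec_add, Matrix.mulVec_sub, smul_dotProduct,
    dotProduct_smul, add_dotProduct, dotProduct_add, sub_dotProduct, dotProduct_sub,
    smul_eq_mul] at hq hJ ⊢
  linarith

theorem integral_jumpFunction_nonpos (p : LevyTriplet d ε) (u : EuclideanSpace ℝ (Fin d)) :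
    ∫ z, jumpFunction (inner ℝ u z) ∂p.jump ≤ 0 :=
  integral_nonpos fun _ => jumpFunction_nonpos _

/-- The jump term is nonpositive and is dropped; completing the square around `p.cov⁻¹` applied to
the drift gives the rest. -/
theorem unitKernel_le_half_sharpe (p : LevyTriplet d ε) (u : EuclideanSpace ℝ (Fin d)) :
    unitKernel p u ≤ 1 / 2 * (p.drift.ofLp ⬝ᵥ (p.cov⁻¹).mulVec p.drift.ofLp) := by
  have hJ := integral_jumpFunction_nonpos p u
  set y := p.drift.ofLp with hy
  set w := (p.cov⁻¹).mulVec y with hw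
  have hdet : IsUnit p.cov.det := p.cov_posDef.det_pos.ne'.isUnit
  have hMw : p.cov.mulVec w = y := by
    rw [hw, Matrix.mulVec_mulVec, Matrix.mul_nonsing_inv _ hdet, Matrix.one_mulVec]
  have hpsd : 0 ≤ (u.ofLp - w) ⬝ᵥ p.cov.mulVec (u.ofLp - w) := by
    simpa using p.cov_posDef.posSemidef.dotProduct_mulVec_nonneg (u.ofLp - w)
  have hcomm := p.dotProduct_cov_comm u.ofLp w
  have hin : inner ℝ u p.drift = u.ofLp ⬝ᵥ y := by
    rw [EuclideanSpace.inner_eq_star_dotProduct, hy, dotProduct_comm]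
    simp
  rw [unitKernel, hin]
  simp only [Matrix.mulVec_sub, sub_dotProduct, dotProduct_sub, hMw] at hpsd hcomm
  rw [dotProduct_comm w y] at hpsd
  linarith

theorem exists_forall_unitKernel_le (hε : 0 < ε) (hε2 : ε ≤ 2) {p : LevyTriplet d ε}
    (hp : p ∈ boundedTriplets d ε) : ∃ u, ∀ v, unitKernel p v ≤ unitKernel p u := by
  obtain ⟨c, hc, hcu⟩ := exists_forall_mul_sq_norm_le p
  -- Beyond this radius the quadratic term outweighs the drift and the kernel falls below its value
  -- `0` at the origin, so a maximum over the ball is global.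
  have hout : ∀ u, 2 * ‖p.drift‖ / c < ‖u‖ → unitKernel p u ≤ 0 := by
    intro u hu
    rw [div_lt_iff₀ hc] at hu
    have h1 := real_inner_le_norm u p.drift
    have h2 := integral_jumpFunction_nonpos p u
    have h3 := hcu u
    rw [unitKernel]
    nlinarith [norm_nonneg u]
  obtain ⟨u, -, hmax⟩ := (isCompact_closedBall (0 : EuclideanSpace ℝ (Fin d))
    (2 * ‖p.drift‖ / c)).exists_isMaxOn ⟨0, Metric.mem_closedBall_self (by positivity)⟩
    (continuous_unitKernel hε hε2 hp).continuousOn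
  refine ⟨u, fun v => ?_⟩
  rcases le_or_gt ‖v‖ (2 * ‖p.drift‖ / c) with h | h
  · exact isMaxOn_iff.1 hmax v (by simpa using h)
  · refine (hout v h).trans ?_
    have := isMaxOn_iff.1 hmax 0 (Metric.mem_closedBall_self (by positivity))
    rwa [unitKernel_zero] at this

/-- A maximizer of the unit kernel. -/
def unitArgmax (p : LevyTriplet d ε) : EuclideanSpace ℝ (Fin d) :=
  Classical.epsilon fun u => ∀ v, unitKernel p v ≤ unitKernel p u

theorem unitKernel_le_argmax (hε : 0 < ε) (hε2 : ε ≤ 2) {p : LevyTriplet d ε}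
    (hp : p ∈ boundedTriplets d ε) (v : EuclideanSpace ℝ (Fin d)) :
    unitKernel p v ≤ unitKernel p (unitArgmax p) :=
  Classical.epsilon_spec (exists_forall_unitKernel_le hε hε2 hp) v

/-- The kernel at the midpoint of `u` and the maximizer does not exceed the maximum, so strong
concavity becomes quadratic growth. The maximizer is therefore unique, and maximizing families
converge to it. -/
theorem exists_sq_norm_sub_argmax_le (hε : 0 < ε) (hε2 : ε ≤ 2) {p : LevyTriplet d ε}
    (hp : p ∈ boundedTriplets d ε) : ∃ c : ℝ, 0 < c ∧ ∀ u,
      c * ‖u - unitArgmax p‖ ^ 2 ≤ unitKernel p (unitArgmax p) - unitKernel p u := by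
  obtain ⟨c, hc, h⟩ := exists_unitKernel_midpoint hp
  refine ⟨2 * c, by positivity, fun u => ?_⟩
  have h1 := h u (unitArgmax p)
  have h2 := unitKernel_le_argmax hε hε2 hp ((1 / 2 : ℝ) • (u + unitArgmax p))
  linarith

theorem tendsto_unitArgmax (hε : 0 < ε) (hε2 : ε ≤ 2) {p : LevyTriplet d ε}
    (hp : p ∈ boundedTriplets d ε) {α : Type*} {l : Filter α}
    {u : α → EuclideanSpace ℝ (Fin d)}
    (h : Tendsto (fun a => unitKernel p (u a)) l (𝓝 (unitKernel p (unitArgmax p)))) :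
    Tendsto u l (𝓝 (unitArgmax p)) := by
  obtain ⟨c, hc, hcu⟩ := exists_sq_norm_sub_argmax_le hε hε2 hp
  rw [tendsto_iff_norm_sub_tendsto_zero]
  have h1 : Tendsto (fun a => √((unitKernel p (unitArgmax p) - unitKernel p (u a)) / c)) l
      (𝓝 0) := by
    simpa using ((h.const_sub (unitKernel p (unitArgmax p))).div_const c).sqrt
  refine squeeze_zero (fun _ => norm_nonneg _) (fun a => ?_) h1
  refine Real.le_sqrt_of_sq_le ?_
  rw [le_div_iff₀ hc, mul_comm]
  exact hcu (u a)

attribute [irreducible] unitKernel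

end UnitKernel

/-! ### The local saddle point -/

section LocalSaddle

variable {d : ℕ} {ε : ℝ}

/-- The kernel is affine in the triplet. Bounded jumps make both jump integrals converge, without
which the integral would not be additive in the measure. -/
theorem unitKernel_of_toProd_eq {p q r : LevyTriplet d ε} {n m : ℕ} (hp : p.JumpsIn n)
    (hq : q.JumpsIn m) {b c : ℝ≥0} (h : r.toProd = b • p.toProd + c • q.toProd)
    (u : EuclideanSpace ℝ (Fin d)) :
    unitKernel r u = b * unitKernel p u + c * unitKernel q u := by
  simp only [LevyTriplet.toProd, Prod.smul_mk, Prod.mk_add_mk, Prod.mk.injEq] at h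
  obtain ⟨h1, h2, h3⟩ := h
  simp only [unitKernel, h1, h2, h3]
  rw [integral_add_measure ((integrable_jumpFunction hp u).smul_measure_nnreal)
    ((integrable_jumpFunction hq u).smul_measure_nnreal), integral_smul_nnreal_measure,
    integral_smul_nnreal_measure]
  simp only [NNReal.smul_def, inner_add_right, real_inner_smul_right, Matrix.add_mulVec,
    Matrix.smul_mulVec, dotProduct_add, dotProduct_smul, smul_eq_mul]
  ring

/-- A minimizer of the maximal kernel over a convex set forms a saddle point with its
maximizer. -/
theorem unitKernel_saddle (hε : 0 < ε) (hε2 : ε ≤ 2) {S : Set (LevyTriplet d ε)}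
    (hS : S ⊆ boundedTriplets d ε) (hconv : Convex ℝ≥0 (LevyTriplet.toProd '' S))
    {p : LevyTriplet d ε} (hp : p ∈ S)
    (hmin : ∀ q ∈ S, unitKernel p (unitArgmax p) ≤ unitKernel q (unitArgmax q))
    {q : LevyTriplet d ε} (hq : q ∈ S) :
    unitKernel p (unitArgmax p) ≤ unitKernel q (unitArgmax p) := by
  set V := unitKernel p (unitArgmax p) with hV
  set K := unitKernel q (unitArgmax q) with hK
  have hVK : V ≤ K := hmin q hq
  -- Here `u` maximizes the mixture `b • p + c • q`, whose maximum is at least `V`. As `p`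
  -- contributes at most `b * V`, `q` has at least `V` there; as `q` contributes at most `c * K`,
  -- `p` loses at most `c / b * (K - V)`, and `c / b = 1 / (k + 1)`.
  have hex : ∀ k : ℕ, ∃ u, V ≤ unitKernel q u ∧ V - (K - V) / (k + 1) ≤ unitKernel p u := by
    intro k
    let b : ℝ≥0 := (k + 1) / (k + 2)
    let c : ℝ≥0 := 1 / (k + 2)
    have hbc : b + c = 1 := by
      simp only [b, c]
      field_simp
      ring
    obtain ⟨r, hr, hrp⟩ := hconv (mem_image_of_mem _ hp) (mem_image_of_mem _ hq)
      (zero_le : 0 ≤ b) (zero_le : 0 ≤ c) hbc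
    obtain ⟨-, n, hn⟩ := hS hp
    obtain ⟨-, m, hm⟩ := hS hq
    have hru := unitKernel_of_toProd_eq hn hm hrp (unitArgmax r)
    have h1 := hmin r hr
    rw [hru] at h1
    have h2 := unitKernel_le_argmax hε hε2 (hS hp) (unitArgmax r)
    have h3 := unitKernel_le_argmax hε hε2 (hS hq) (unitArgmax r)
    rw [← hV] at h2
    rw [← hK] at h3
    have hbc' : (b : ℝ) + c = 1 := by exact_mod_cast hbc
    have hb : (b : ℝ) = (k + 1) / (k + 2) := by simp [b]
    have hc : (c : ℝ) = 1 / (k + 2) := by simp [c]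
    have hc0 : 0 < (c : ℝ) := by rw [hc]; positivity
    have hb0 : 0 < (b : ℝ) := by rw [hb]; positivity
    have e1 : V = b * V + c * V := by rw [← add_mul, hbc', one_mul]
    have e2 : b * unitKernel p (unitArgmax r) ≤ b * V := by gcongr
    have e3 : c * unitKernel q (unitArgmax r) ≤ c * K := by gcongr
    refine ⟨unitArgmax r, ?_, ?_⟩
    · have : c * V ≤ c * unitKernel q (unitArgmax r) := by linarith
      exact le_of_mul_le_mul_left this hc0
    · have h4 : b * (V - (K - V) / (k + 1)) ≤ b * unitKernel p (unitArgmax r) := by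
        have : (b : ℝ) * ((K - V) / (k + 1)) = c * (K - V) := by
          rw [hb, hc]; field_simp
        rw [mul_sub, this, mul_sub]
        linarith
      exact le_of_mul_le_mul_left h4 hb0
  choose u hu1 hu2 using hex
  have hlim : Tendsto (fun k => unitKernel p (u k)) atTop (𝓝 V) := by
    refine tendsto_of_tendsto_of_tendsto_of_le_of_le (g := fun k : ℕ => V - (K - V) / (k + 1))
      ?_ tendsto_const_nhds hu2 fun k => unitKernel_le_argmax hε hε2 (hS hp) (u k)
    have := (tendsto_one_div_add_atTop_nhds_zero_nat (𝕜 := ℝ)).const_mul (K - V)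
    simpa [div_eq_mul_inv] using this.const_sub V
  -- The points `u k` maximize the kernel of `p` asymptotically, so they converge to its maximizer,
  -- and `V ≤ unitKernel q (u k)` passes to the limit.
  exact ge_of_tendsto' (((continuous_unitKernel hε hε2 (hS hq)).tendsto _).comp
    (tendsto_unitArgmax hε hε2 (hS hp) hlim)) hu1

theorem isFiniteMeasure_weightedMeasure_zero :
    IsFiniteMeasure (weightedMeasure ε (0 : Measure (EuclideanSpace ℝ (Fin d)))) := by
  rw [weightedMeasure, withDensity_zero_left]
  infer_instance

theorem HasRegularJumps.exists_jumpsIn {S : Set (LevyTriplet d ε)} (h : HasRegularJumps S) :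
    ∃ n : ℕ, ∀ p ∈ S, p.JumpsIn n := by
  obtain ⟨-, κ, -, -, hκ, -⟩ := h
  obtain ⟨n, hn⟩ := exists_nat_ge κ
  refine ⟨n, fun p hp => measure_mono_null (compl_subset_compl.2 ?_) Measure.measure_compl_support⟩
  refine Subset.trans (Subset.trans ?_ (subset_convexHull ℝ _)) (hκ.trans
    (Metric.closedBall_subset_closedBall hn))
  exact (subset_biUnion_of_mem (u := fun p : LevyTriplet d ε => p.jump.support) hp).trans
    subset_union_left

theorem HasRegularJumps.subset_boundedTriplets {S : Set (LevyTriplet d ε)}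
    (h : HasRegularJumps S) : S ⊆ boundedTriplets d ε := by
  obtain ⟨n, hn⟩ := h.exists_jumpsIn
  obtain ⟨-, κ, -, -, -, hκ⟩ := h
  refine fun p hp => ⟨isFiniteMeasure_weightedMeasure_of_levyEDist
    isFiniteMeasure_weightedMeasure_zero (lt_of_le_of_lt (hκ p hp).2.2 ENNReal.ofReal_lt_top),
    n, hn p hp⟩

end LocalSaddle

/-! ### Measurability in time of kernels, maximizers and minimizers -/

section Measurability

variable {d : ℕ} {ε : ℝ} {ι : Type*} [MeasurableSpace ι]

theorem measurable_cutoffKernel (hε : 0 < ε) (hε2 : ε ≤ 2) {θ : ι → LevyTriplet d ε}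
    (hθ : Measurable θ) (hθf : ∀ t, θ t ∈ finiteTriplets d ε) (n : ℕ)
    (u : EuclideanSpace ℝ (Fin d)) : Measurable fun t => cutoffKernel n (θ t) u := by
  have hc : Continuous fun p : finiteTriplets d ε => cutoffKernel n (p : LevyTriplet d ε) u :=
    (continuousOn_cutoffKernel hε hε2 n).comp_continuous
      (f := fun p : finiteTriplets d ε => (u, (p : LevyTriplet d ε)))
      (by fun_prop) fun p => ⟨trivial, p.2⟩
  have hm : Measurable fun t => (⟨θ t, hθf t⟩ : finiteTriplets d ε) := hθ.subtype_mk
  exact hc.measurable.comp hm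

theorem measurable_unitKernel (hε : 0 < ε) (hε2 : ε ≤ 2) {θ : ι → LevyTriplet d ε}
    (hθ : Measurable θ) (hθb : ∀ t, θ t ∈ boundedTriplets d ε)
    (u : EuclideanSpace ℝ (Fin d)) : Measurable fun t => unitKernel (θ t) u := by
  refine measurable_of_tendsto_metrizable (f := fun n t => cutoffKernel n (θ t) u)
    (fun n => measurable_cutoffKernel hε hε2 hθ (fun t => (hθb t).1) n u) ?_
  rw [tendsto_pi_nhds]
  intro t
  obtain ⟨-, n, hn⟩ := hθb t
  refine tendsto_const_nhds.congr' ?_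
  filter_upwards [eventually_ge_atTop n] with m hm
  exact unitKernel_eq_cutoffKernel (hn.mono hm) u

theorem measurable_unitKernel_comp (hε : 0 < ε) (hε2 : ε ≤ 2) {θ : ι → LevyTriplet d ε}
    (hθ : Measurable θ) (hθb : ∀ t, θ t ∈ boundedTriplets d ε)
    {w : ι → EuclideanSpace ℝ (Fin d)} (hw : Measurable w) :
    Measurable fun t => unitKernel (θ t) (w t) := by
  have h1 : Measurable (Function.uncurry fun u t => unitKernel (θ t) u) :=
    measurable_uncurry_of_continuous_of_measurable
      (fun t => continuous_unitKernel hε hε2 (hθb t))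
      (fun u => measurable_unitKernel hε hε2 hθ hθb u)
  have h2 : Measurable fun t => (w t, t) := hw.prodMk measurable_id
  exact h1.comp h2

/-- By continuity the maximum is a supremum over a dense sequence, hence measurable. The first dense
point within `1/(j+1)` of it is measurable in time, and quadratic growth forces these points to
converge to the maximizer. -/
theorem measurable_unitArgmax (hε : 0 < ε) (hε2 : ε ≤ 2) {θ : ι → LevyTriplet d ε}
    (hθ : Measurable θ) (hθb : ∀ t, θ t ∈ boundedTriplets d ε) :
    Measurable fun t => unitArgmax (θ t) := by
  classical
  let e := TopologicalSpace.denseSeq (EuclideanSpace ℝ (Fin d))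
  let v : ι → ℝ := fun t => ⨆ n, unitKernel (θ t) (e n)
  have hle : ∀ t n, unitKernel (θ t) (e n) ≤ unitKernel (θ t) (unitArgmax (θ t)) :=
    fun t n => unitKernel_le_argmax hε hε2 (hθb t) _
  have hv : ∀ t, v t = unitKernel (θ t) (unitArgmax (θ t)) := by
    intro t
    have hbdd : BddAbove (range fun n => unitKernel (θ t) (e n)) :=
      ⟨_, forall_mem_range.2 (hle t)⟩
    refine le_antisymm (ciSup_le (hle t)) ?_
    have hcl : IsClosed {u | unitKernel (θ t) u ≤ v t} :=
      isClosed_le (continuous_unitKernel hε hε2 (hθb t)) continuous_const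
    have hsub : closure (range e) ⊆ {u | unitKernel (θ t) u ≤ v t} :=
      closure_minimal (range_subset_iff.2 fun n => le_ciSup hbdd n) hcl
    exact hsub (TopologicalSpace.denseRange_denseSeq _ _)
  have hvm : Measurable v := Measurable.iSup fun n => measurable_unitKernel hε hε2 hθ hθb (e n)
  have hex : ∀ (j : ℕ) t, ∃ n, v t - 1 / ((j : ℝ) + 1) < unitKernel (θ t) (e n) :=
    fun j t => exists_lt_of_lt_ciSup (sub_lt_self _ (by positivity))
  let N : ℕ → ι → ℕ := fun j t => Nat.find (hex j t)
  have hN : ∀ j, Measurable (N j) := fun j => measurable_find (hex j) fun n =>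
    measurableSet_lt (hvm.sub_const _) (measurable_unitKernel hε hε2 hθ hθb (e n))
  refine measurable_of_tendsto_metrizable (f := fun j t => e (N j t))
    (fun j => (measurable_from_top (f := e)).comp (hN j)) ?_
  rw [tendsto_pi_nhds]
  intro t
  refine tendsto_unitArgmax hε hε2 (hθb t) ?_
  rw [← hv]
  refine tendsto_of_tendsto_of_tendsto_of_le_of_le
    (g := fun j : ℕ => v t - 1 / ((j : ℝ) + 1)) ?_ tendsto_const_nhds
    (fun j => (Nat.find_spec (hex j t)).le) fun j => (hle t _).trans (hv t).ge
  simpa using (tendsto_one_div_add_atTop_nhds_zero_nat (𝕜 := ℝ)).const_sub (v t)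

theorem isClosed_cutoffKernel_le (hε : 0 < ε) (hε2 : ε ≤ 2) (n : ℕ) (r : ℝ) :
    IsClosed {x : EuclideanSpace ℝ (Fin d) × LevyTriplet d ε |
      x.2 ∈ finiteTriplets d ε ∧ cutoffKernel n x.2 x.1 ≤ r} := by
  have := (continuousOn_cutoffKernel hε hε2 n).preimage_isClosed_of_isClosed
    (isClosed_univ.prod (isClosed_finiteTriplets (d := d) (ε := ε))) (isClosed_Iic (a := r))
  convert this using 1
  ext x
  simp

theorem isClosed_forall_cutoffKernel_le (hε : 0 < ε) (hε2 : ε ≤ 2) (n : ℕ) (r : ℝ) :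
    IsClosed {p : LevyTriplet d ε | ∀ u, p ∈ finiteTriplets d ε ∧ cutoffKernel n p u ≤ r} := by
  rw [ofPred_forall]
  exact isClosed_iInter fun u => (isClosed_cutoffKernel_le hε hε2 n r).preimage
    (f := fun p : LevyTriplet d ε => (u, p)) (by fun_prop)

/-- Measurable selection of minimizers of a function with closed sublevel sets that can eventually
be described by a sequence of closed relations. -/
theorem exists_measurable_argmin_of_eventually {X : Type*} [PseudoEMetricSpace X]
    [MeasurableSpace X] [BorelSpace X] {C : Set X} (hC : IsCompact C) {S : ι → Set X}
    (hSC : ∀ t, S t ⊆ C) (hne : ∀ t, (S t).Nonempty) (hcl : ∀ t, IsClosed (S t))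
    {f : ι → X → ℝ} {Q : ℕ → ℝ → ι → Set X} (hQ : ∀ n r t, IsClosed (Q n r t))
    (hfQ : ∀ t, ∃ n, ∀ m ≥ n, ∀ p ∈ S t, ∀ r, f t p ≤ r ↔ p ∈ Q m r t)
    (hm : ∀ F, IsClosed F → ∀ n r, MeasurableSet {t | ∃ p ∈ S t, p ∈ F ∧ p ∈ Q n r t}) :
    ∃ g : ι → X, Measurable g ∧ ∀ t, g t ∈ S t ∧ ∀ p ∈ S t, f t (g t) ≤ f t p := by
  refine exists_measurable_argmin hC hSC hne (fun t r => ?_) fun F hF r => ?_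
  · obtain ⟨n, hn⟩ := hfQ t
    have : {p | p ∈ S t ∧ f t p ≤ r} = S t ∩ Q n r t := by
      ext p
      exact and_congr_right fun hp => hn n le_rfl p hp r
    rw [this]
    exact (hcl t).inter (hQ n r t)
  -- The threshold `n` depends on `t` with no measurability known, so the set is written as a lower
  -- limit of the sets for the relations `Q m`.
  · have : {t | ∃ p ∈ S t, p ∈ F ∧ f t p ≤ r} =
        ⋃ n : ℕ, ⋂ m : ℕ, ⋂ _ : m ≥ n, {t | ∃ p ∈ S t, p ∈ F ∧ p ∈ Q m r t} := by
      ext t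
      obtain ⟨n, hn⟩ := hfQ t
      simp only [mem_iUnion, mem_iInter, mem_ofPred_eq]
      constructor
      · rintro ⟨p, hp, hpF, hpr⟩
        exact ⟨n, fun m hnm => ⟨p, hp, hpF, (hn m hnm p hp r).1 hpr⟩⟩
      · rintro ⟨k, hk⟩
        obtain ⟨p, hp, hpF, hpQ⟩ := hk (max k n) (le_max_left _ _)
        exact ⟨p, hp, hpF, (hn _ (le_max_right _ _) p hp r).2 hpQ⟩
    rw [this]
    exact MeasurableSet.iUnion fun n => MeasurableSet.iInter fun m => MeasurableSet.iInter
      fun _ => hm F hF m r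

variable {C : Set (LevyTriplet d ε)} {S : ι → Set (LevyTriplet d ε)}

/-- A sublevel set of the maximal kernel is an intersection of sublevel sets over all `u`, hence
closed; continuity of the maximizer in the triplet is not needed. -/
theorem exists_measurable_minimizer_max (hε : 0 < ε) (hε2 : ε ≤ 2) (hC : IsCompact C)
    (hSC : ∀ t, S t ⊆ C) (hne : ∀ t, (S t).Nonempty) (hcl : ∀ t, IsClosed (S t))
    (hm : ∀ G, IsOpen G → MeasurableSet {t | (S t ∩ G).Nonempty})
    (hS : ∀ t, HasRegularJumps (S t)) :
    ∃ θ : ι → LevyTriplet d ε, Measurable θ ∧ ∀ t, θ t ∈ S t ∧ ∀ p ∈ S t,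
      unitKernel (θ t) (unitArgmax (θ t)) ≤ unitKernel p (unitArgmax p) := by
  refine exists_measurable_argmin_of_eventually hC hSC hne hcl
    (f := fun _ p => unitKernel p (unitArgmax p))
    (Q := fun n r _ => {p | ∀ u, p ∈ finiteTriplets d ε ∧ cutoffKernel n p u ≤ r})
    (fun n r _ => isClosed_forall_cutoffKernel_le hε hε2 n r) (fun t => ?_) fun F hF n r => ?_
  · obtain ⟨n, hn⟩ := (hS t).exists_jumpsIn
    refine ⟨n, fun m hm p hp r => ?_⟩
    have hpb := (hS t).subset_boundedTriplets hp
    have heq := fun u => unitKernel_eq_cutoffKernel ((hn p hp).mono hm) u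
    constructor
    · intro h u
      exact ⟨hpb.1, (heq u).ge.trans ((unitKernel_le_argmax hε hε2 hpb u).trans h)⟩
    · intro h
      exact (heq _).trans_le (h _).2
  · exact measurableSet_nonempty_inter_of_isClosed
      (fun t => hC.of_isClosed_subset (hcl t) (hSC t)) hm
      (hF.inter (isClosed_forall_cutoffKernel_le hε hε2 n r))

/-- This serves an arbitrary policy. The objective now depends on `t` also through `w t`, so the
sublevel relation is a closed subset of the product of positions and triplets. -/
theorem exists_measurable_minimizer_at (hε : 0 < ε) (hε2 : ε ≤ 2) (hC : IsCompact C)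
    (hSC : ∀ t, S t ⊆ C) (hne : ∀ t, (S t).Nonempty) (hcl : ∀ t, IsClosed (S t))
    (hm : ∀ G, IsOpen G → MeasurableSet {t | (S t ∩ G).Nonempty})
    (hS : ∀ t, HasRegularJumps (S t)) {w : ι → EuclideanSpace ℝ (Fin d)} (hw : Measurable w) :
    ∃ θ : ι → LevyTriplet d ε, Measurable θ ∧ ∀ t, θ t ∈ S t ∧ ∀ p ∈ S t,
      unitKernel (θ t) (w t) ≤ unitKernel p (w t) := by
  refine exists_measurable_argmin_of_eventually hC hSC hne hcl
    (f := fun t p => unitKernel p (w t))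
    (Q := fun n r t => {p | p ∈ finiteTriplets d ε ∧ cutoffKernel n p (w t) ≤ r})
    (fun n r t => (isClosed_cutoffKernel_le hε hε2 n r).preimage
      (f := fun p : LevyTriplet d ε => (w t, p)) (by fun_prop)) (fun t => ?_) fun F hF n r => ?_
  · obtain ⟨n, hn⟩ := (hS t).exists_jumpsIn
    refine ⟨n, fun m hm p hp r => ?_⟩
    have hpb := (hS t).subset_boundedTriplets hp
    rw [unitKernel_eq_cutoffKernel ((hn p hp).mono hm)]
    exact ⟨fun h => ⟨hpb.1, h⟩, fun h => h.2⟩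
  · exact measurableSet_exists_mem_of_isClosed_prod
      (fun t => hC.of_isClosed_subset (hcl t) (hSC t)) hm hw
      (F := {x | x.2 ∈ F ∧ x.2 ∈ finiteTriplets d ε ∧ cutoffKernel n x.2 x.1 ≤ r})
      ((hF.preimage continuous_snd).inter (isClosed_cutoffKernel_le hε hε2 n r))

end Measurability

/-! ### The global kernel as a one-dimensional integral functional -/

section RealAnalysis

theorem AbsolutelyContinuousOnInterval.lipschitzOnWith_comp {f : ℝ → ℝ} {s t : ℝ}
    (hf : AbsolutelyContinuousOnInterval f s t) {φ : ℝ → ℝ} {K : ℝ≥0}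
    (hφ : LipschitzOnWith K φ (f '' uIcc s t)) :
    AbsolutelyContinuousOnInterval (fun x => φ (f x)) s t := by
  have hlim : Tendsto (fun E : ℕ × (ℕ → ℝ × ℝ) =>
      K * ∑ i ∈ Finset.range E.1, dist (f (E.2 i).1) (f (E.2 i).2))
      (totalLengthFilter ⊓ 𝓟 (disjWithin s t)) (𝓝 0) := by
    simpa using Tendsto.const_mul (K : ℝ) hf
  refine squeeze_zero' (Eventually.of_forall fun E => by positivity) ?_ hlim
  filter_upwards [mem_inf_of_right (mem_principal_self _)] with E hE
  rw [Finset.mul_sum]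
  refine Finset.sum_le_sum fun i hi => ?_
  exact hφ.dist_le_mul _ (mem_image_of_mem f (hE.1 i hi).1) _ (mem_image_of_mem f (hE.1 i hi).2)

variable {a T : ℝ} {r : ℝ → ℝ}

theorem continuousOn_integral_of_intervalIntegrable (hT : 0 ≤ T)
    (hr : IntervalIntegrable r volume 0 T) :
    ContinuousOn (fun t => ∫ s in (0 : ℝ)..t, r s) (Icc 0 T) := by
  rw [← uIcc_of_le hT]
  exact (hr.absolutelyContinuousOnInterval_intervalIntegral left_mem_uIcc).continuousOn

/-- The rate is merely integrable, so the exponential of its primitive is only absolutely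
continuous; the fundamental theorem is applied in that class. -/
theorem intervalIntegral_exp_mul (hr : IntervalIntegrable r volume 0 T) :
    ∫ t in (0 : ℝ)..T, -a * (Real.exp (-a * ∫ s in (0 : ℝ)..t, r s) * r t) =
      Real.exp (-a * ∫ s in (0 : ℝ)..T, r s) - 1 := by
  have hR := hr.absolutelyContinuousOnInterval_intervalIntegral left_mem_uIcc
  obtain ⟨B, hB⟩ := hR.exists_bound
  have hsub : (fun t => ∫ s in (0 : ℝ)..t, r s) '' uIcc 0 T ⊆ Icc (-B) B := by
    rintro _ ⟨t, ht, rfl⟩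
    exact abs_le.1 (hB t ht)
  have hφ : ContDiff ℝ 1 fun x : ℝ => Real.exp (-a * x) := by fun_prop
  obtain ⟨K, hK⟩ := hφ.contDiffOn.exists_lipschitzOnWith (by decide) (convex_Icc (-B) B)
    isCompact_Icc
  have hac := hR.lipschitzOnWith_comp (hK.mono hsub)
  have h := hac.integral_deriv_eq_sub
  simp only [intervalIntegral.integral_same, mul_zero, Real.exp_zero] at h
  rw [← h]
  refine intervalIntegral.integral_congr_ae ?_
  filter_upwards [hr.ae_hasDerivAt_integral] with t ht htI
  have hd := ht (uIoc_subset_uIcc htI) 0 left_mem_uIcc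
  rw [((hd.const_mul (-a)).exp).deriv]
  ring

theorem intervalIntegrable_exp_mul (hT : 0 ≤ T) (hr : IntervalIntegrable r volume 0 T)
    {f : ℝ → ℝ} (hf : IntervalIntegrable f volume 0 T) (b : ℝ) :
    IntervalIntegrable (fun t => Real.exp (b * ∫ s in (0 : ℝ)..t, r s) * f t) volume 0 T := by
  refine hf.continuousOn_mul ?_
  rw [uIcc_of_le hT]
  exact Real.continuous_exp.comp_continuousOn
    (continuousOn_const.mul (continuousOn_integral_of_intervalIntegrable hT hr))

/-- The value of the global kernel, after integration of its rate term. -/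
theorem integral_kernel_eq (ha : a ≠ 0) (hT : 0 ≤ T) (hr : IntervalIntegrable r volume 0 T)
    {D : ℝ → ℝ} (hi : IntervalIntegrable (fun t => Real.exp (-a * ∫ s in (0 : ℝ)..t, r s) *
      (r t + caraUtility a (D t))) volume 0 T) :
    IntervalIntegrable (fun t => Real.exp (-a * ((∫ s in (0 : ℝ)..t, r s) + D t))) volume 0 T ∧
    ∫ t in (0 : ℝ)..T, Real.exp (-a * ∫ s in (0 : ℝ)..t, r s) * (r t + caraUtility a (D t)) =
      1 / a * (1 - Real.exp (-a * ∫ s in (0 : ℝ)..T, r s) -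
        ∫ t in (0 : ℝ)..T, Real.exp (-a * ((∫ s in (0 : ℝ)..t, r s) + D t))) := by
  -- Integrability of `exp (-a * (R + D))` is not assumed: it is `a` times the difference of the
  -- rate term and the whole integrand.
  have h1 := intervalIntegrable_exp_mul hT hr hr (-a)
  have h2 : IntervalIntegrable (fun t => Real.exp (-a * ((∫ s in (0 : ℝ)..t, r s) + D t)))
      volume 0 T := by
    refine ((h1.sub hi).const_mul a).congr fun t _ => ?_
    simp only [caraUtility, mul_add (-a), Real.exp_add]
    field_simp
    ring
  refine ⟨h2, ?_⟩
  have h3 := intervalIntegral_exp_mul (a := a) hr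
  rw [intervalIntegral.integral_const_mul] at h3
  have h4 : ∀ t, Real.exp (-a * ∫ s in (0 : ℝ)..t, r s) * (r t + caraUtility a (D t)) =
      -(1 / a) * (-a * (Real.exp (-a * ∫ s in (0 : ℝ)..t, r s) * r t)) -
        1 / a * Real.exp (-a * ((∫ s in (0 : ℝ)..t, r s) + D t)) := by
    intro t
    simp only [caraUtility, mul_add (-a), Real.exp_add]
    field_simp
    ring
  simp_rw [h4]
  rw [intervalIntegral.integral_sub ((h1.const_mul _).const_mul _) (h2.const_mul _),
    intervalIntegral.integral_const_mul, intervalIntegral.integral_const_mul,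
    intervalIntegral.integral_const_mul, h3]
  ring

/-- Monotonicity is visible only after integration of the rate term: raising `r` raises its
primitive, and both remaining exponentials decrease. -/
theorem integral_kernel_mono (ha : 0 < a) (hT : 0 ≤ T) {r' : ℝ → ℝ} {D : ℝ → ℝ}
    (hr : IntervalIntegrable r volume 0 T) (hr' : IntervalIntegrable r' volume 0 T)
    (hle : ∀ t ∈ Icc 0 T, r t ≤ r' t)
    (hi : IntervalIntegrable (fun t => Real.exp (-a * ∫ s in (0 : ℝ)..t, r s) *
      (r t + caraUtility a (D t))) volume 0 T)
    (hi' : IntervalIntegrable (fun t => Real.exp (-a * ∫ s in (0 : ℝ)..t, r' s) *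
      (r' t + caraUtility a (D t))) volume 0 T) :
    ∫ t in (0 : ℝ)..T, Real.exp (-a * ∫ s in (0 : ℝ)..t, r s) * (r t + caraUtility a (D t)) ≤
      ∫ t in (0 : ℝ)..T, Real.exp (-a * ∫ s in (0 : ℝ)..t, r' s) *
        (r' t + caraUtility a (D t)) := by
  obtain ⟨h1, h2⟩ := integral_kernel_eq ha.ne' hT hr hi
  obtain ⟨h1', h2'⟩ := integral_kernel_eq ha.ne' hT hr' hi'
  have hR : ∀ t ∈ Icc 0 T, ∫ s in (0 : ℝ)..t, r s ≤ ∫ s in (0 : ℝ)..t, r' s := by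
    intro t ht
    have hsub : uIcc 0 t ⊆ uIcc 0 T := by
      rw [uIcc_of_le ht.1, uIcc_of_le hT]
      exact Icc_subset_Icc_right ht.2
    exact intervalIntegral.integral_mono_on ht.1 (hr.mono_set hsub) (hr'.mono_set hsub)
      fun s hs => hle s ⟨hs.1, hs.2.trans ht.2⟩
  rw [h2, h2']
  have hJ : ∫ t in (0 : ℝ)..T, Real.exp (-a * ((∫ s in (0 : ℝ)..t, r' s) + D t)) ≤
      ∫ t in (0 : ℝ)..T, Real.exp (-a * ((∫ s in (0 : ℝ)..t, r s) + D t)) := by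
    refine intervalIntegral.integral_mono_on hT h1' h1 fun t ht => Real.exp_le_exp.2 ?_
    have := hR t ht
    nlinarith
  have hE : Real.exp (-a * ∫ s in (0 : ℝ)..T, r' s) ≤ Real.exp (-a * ∫ s in (0 : ℝ)..T, r s) := by
    refine Real.exp_le_exp.2 ?_
    have := hR T ⟨hT, le_rfl⟩
    nlinarith
  gcongr

theorem consumptionScale_pos {t : ℝ} (ht : t ≤ T) : 0 < consumptionScale T t :=
  inv_pos.2 (by linarith)

theorem continuousOn_consumptionScale : ContinuousOn (consumptionScale T) (Icc 0 T) := by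
  unfold consumptionScale
  exact ContinuousOn.inv₀ (by fun_prop) fun t ht => by linarith [ht.2]

theorem contDiffOn_consumptionScale : ContDiffOn ℝ 1 (consumptionScale T) (Icc 0 T) := by
  unfold consumptionScale
  exact ContDiffOn.inv (by fun_prop) fun t ht => by linarith [ht.2]

theorem hasDerivAt_consumptionScale {t : ℝ} (ht : t ≤ T) :
    HasDerivAt (consumptionScale T) (consumptionScale T t ^ 2) t := by
  have h : HasDerivAt (fun t => T - t + 1) (-1) t := by
    simpa using ((hasDerivAt_id t).const_sub T).add_const 1
  refine HasDerivAt.congr_deriv (f := consumptionScale T) (h.inv (by linarith)) ?_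
  simp [consumptionScale]

/-- Integration by parts of the accumulated rate. -/
theorem integral_integral_add_integral (hr : IntervalIntegrable r volume 0 T) :
    (∫ t in (0 : ℝ)..T, ∫ s in (0 : ℝ)..t, r s) + ∫ s in (0 : ℝ)..T, r s =
      ∫ t in (0 : ℝ)..T, (T - t + 1) * r t := by
  have hR := hr.absolutelyContinuousOnInterval_intervalIntegral left_mem_uIcc
  have hg : AbsolutelyContinuousOnInterval (fun t => T - t + 1) 0 T :=
    ContDiffOn.absolutelyContinuousOnInterval (by fun_prop)
  -- The primitive vanishes at `0` and `T - t + 1` equals `1` at `T`, so the only boundary term is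
  -- the total rate.
  have h := hR.integral_mul_deriv_eq_deriv_mul hg
  have hd : ∀ t : ℝ, deriv (fun t => T - t + 1) t = -1 := by
    intro t
    have : HasDerivAt (fun t => T - t + 1) (-1) t := by
      simpa using ((hasDerivAt_id t).const_sub T).add_const 1
    exact this.deriv
  simp only [hd, mul_neg, mul_one, intervalIntegral.integral_neg, sub_self, zero_add,
    intervalIntegral.integral_same, zero_mul, sub_zero] at h
  have h2 : ∫ t in (0 : ℝ)..T, deriv (fun x => ∫ s in (0 : ℝ)..x, r s) t * (T - t + 1) =
      ∫ t in (0 : ℝ)..T, (T - t + 1) * r t := by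
    refine intervalIntegral.integral_congr_ae ?_
    filter_upwards [hr.ae_hasDerivAt_integral] with t ht htI
    rw [(ht (uIoc_subset_uIcc htI) 0 left_mem_uIcc).deriv, mul_comm]
  rw [h2] at h
  linarith

/-- Upper bound of the global kernel, through Jensen's inequality for the exponential. -/
theorem integral_kernel_le (ha : 0 < a) (hT : 0 < T) {h D : ℝ → ℝ}
    (hr : IntervalIntegrable (fun t => consumptionScale T t * (h t - D t)) volume 0 T)
    (hi : IntervalIntegrable (fun t =>
      Real.exp (-a * ∫ s in (0 : ℝ)..t, consumptionScale T s * (h s - D s)) *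
      (consumptionScale T t * (h t - D t) + caraUtility a (D t))) volume 0 T)
    {C : ℝ} (hC : ∀ t ∈ Icc 0 T, h t ≤ C) (hh : AEStronglyMeasurable h (volume.restrict (Ioc 0 T))) :
    IntervalIntegrable h volume 0 T ∧
    ∫ t in (0 : ℝ)..T, Real.exp (-a * ∫ s in (0 : ℝ)..t, consumptionScale T s * (h s - D s)) *
      (consumptionScale T t * (h t - D t) + caraUtility a (D t)) ≤
      1 / a * (1 - (T + 1) * Real.exp (-(a / (T + 1)) * ∫ s in (0 : ℝ)..T, h s)) := by
  set r : ℝ → ℝ := fun t => consumptionScale T t * (h t - D t) with hrdef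
  obtain ⟨h1, h2⟩ := integral_kernel_eq ha.ne' hT.le hr hi
  set R : ℝ → ℝ := fun t => ∫ s in (0 : ℝ)..t, r s with hR
  have hRi : IntervalIntegrable R volume 0 T :=
    ContinuousOn.intervalIntegrable (by
      rw [uIcc_of_le hT.le]; exact continuousOn_integral_of_intervalIntegrable hT.le hr)
  have hhD : IntervalIntegrable (fun t => h t - D t) volume 0 T := by
    have hc : ContinuousOn (fun t : ℝ => T - t + 1) (uIcc 0 T) := by fun_prop
    refine (hr.continuousOn_mul hc).congr fun t ht => ?_
    rw [uIoc_of_le hT.le] at ht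
    have : T - t + 1 ≠ 0 := by linarith [ht.2]
    simp only [hrdef, consumptionScale]
    field_simp
  have hexp : IntervalIntegrable (fun t => Real.exp (-a * (R t + D t))) volume 0 T := h1
  have hhi : IntervalIntegrable h volume 0 T := by
    -- Above, `h ≤ C`. Below, write `h = (h - D) + D` and use `-(R + D) ≤ (1 / a) * exp (-a * (R +
    -- D))`, so that the integrable exponential bounds the negative part.
    have hdom : IntervalIntegrable (fun t => |C| + |h t - D t| + |R t| +
        1 / a * Real.exp (-a * (R t + D t))) volume 0 T :=
      (((intervalIntegrable_const).add hhD.abs).add hRi.abs).add (hexp.const_mul _)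
    rw [intervalIntegrable_iff_integrableOn_Ioc_of_le hT.le] at hdom ⊢
    refine Integrable.mono' hdom hh ?_
    filter_upwards [ae_restrict_mem measurableSet_Ioc] with t ht
    have e1 := hC t ⟨ht.1.le, ht.2⟩
    have e2 := Real.add_one_le_exp (-a * (R t + D t))
    have e3 : -(R t + D t) ≤ 1 / a * Real.exp (-a * (R t + D t)) := by
      rw [one_div, ← div_eq_inv_mul, le_div_iff₀ ha]
      linarith
    have e4 : 0 ≤ 1 / a * Real.exp (-a * (R t + D t)) := by positivity
    rw [Real.norm_eq_abs, abs_le]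
    have e5 := neg_abs_le (h t - D t)
    have e6 := le_abs_self (R t)
    have e7 := abs_nonneg (R t)
    have e8 := abs_nonneg (h t - D t)
    have e9 := le_abs_self C
    have e10 := abs_nonneg C
    have e11 := neg_abs_le (R t)
    constructor <;> linarith
  refine ⟨hhi, ?_⟩
  have hDi : IntervalIntegrable D volume 0 T := by
    simpa using hhi.sub hhD
  have hsum : (∫ t in (0 : ℝ)..T, (R t + D t)) + R T = ∫ t in (0 : ℝ)..T, h t := by
    have e := integral_integral_add_integral hr
    have e' : ∫ t in (0 : ℝ)..T, (T - t + 1) * r t = ∫ t in (0 : ℝ)..T, (h t - D t) := by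
      refine intervalIntegral.integral_congr fun t ht => ?_
      rw [uIcc_of_le hT.le] at ht
      have : T - t + 1 ≠ 0 := by linarith [ht.2]
      simp only [hrdef, consumptionScale]
      field_simp
    rw [e', intervalIntegral.integral_sub hhi hDi] at e
    rw [intervalIntegral.integral_add hRi hDi]
    linarith
  rw [h2]
  set I := ∫ t in (0 : ℝ)..T, h t with hI
  -- This is the mean exponent over `[0,T]` plus an atom of mass `1` at `T`. The tangent of the
  -- exponential at `m`, summed over both, has its first-order terms cancel because `(T + 1) * m =
  -- -a * I`.
  set m := -(a / (T + 1)) * I with hm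
  have htan : ∀ x, Real.exp m * (1 - m) + Real.exp m * x ≤ Real.exp x := by
    intro x
    have e1 := Real.add_one_le_exp (x - m)
    have e2 : Real.exp x = Real.exp m * Real.exp (x - m) := by rw [← Real.exp_add]; congr 1; ring
    rw [e2, ← mul_add]
    gcongr
    linarith
  have hint : ∫ t in (0 : ℝ)..T, (Real.exp m * (1 - m) + Real.exp m * (-a * (R t + D t))) ≤
      ∫ t in (0 : ℝ)..T, Real.exp (-a * (R t + D t)) :=
    intervalIntegral.integral_mono_on hT.le
      (intervalIntegrable_const.add (((hRi.add hDi).const_mul _).const_mul _)) hexp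
      fun t _ => htan _
  rw [intervalIntegral.integral_add intervalIntegrable_const
    (((hRi.add hDi).const_mul _).const_mul _), intervalIntegral.integral_const,
    intervalIntegral.integral_const_mul, intervalIntegral.integral_const_mul, sub_zero,
    smul_eq_mul] at hint
  have hend := htan (-a * R T)
  have hfin : (T + 1) * Real.exp m ≤ Real.exp (-a * R T) +
      ∫ t in (0 : ℝ)..T, Real.exp (-a * (R t + D t)) := by
    have e1 : (T + 1) * m = -a * I := by rw [hm]; field_simp
    have e2 : ∫ t in (0 : ℝ)..T, (R t + D t) = I - R T := by linarith
    rw [e2] at hint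
    have e3 : (T + 1) * Real.exp m = T * (Real.exp m * (1 - m)) +
        Real.exp m * (-a * (I - R T)) + (Real.exp m * (1 - m) + Real.exp m * (-a * R T)) := by
      linear_combination Real.exp m * e1
    linarith
  refine mul_le_mul_of_nonneg_left ?_ (by positivity)
  change 1 - Real.exp (-a * R T) - (∫ t in (0 : ℝ)..T, Real.exp (-a * (R t + D t))) ≤ _
  linarith

/-- The excess consumption that is optimal for the local values `h`. -/
def excessConsumption (T : ℝ) (h : ℝ → ℝ) (t : ℝ) : ℝ :=
  consumptionScale T t * ∫ s in t..T, h s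

theorem excessConsumption_eq (hT : 0 ≤ T) {h : ℝ → ℝ} (hh : IntervalIntegrable h volume 0 T)
    {t : ℝ} (ht : t ∈ Icc 0 T) : excessConsumption T h t =
      consumptionScale T t * ((∫ s in (0 : ℝ)..T, h s) - ∫ s in (0 : ℝ)..t, h s) := by
  have hsub : uIcc 0 t ⊆ uIcc 0 T := by
    rw [uIcc_of_le ht.1, uIcc_of_le hT]
    exact Icc_subset_Icc_right ht.2
  rw [excessConsumption, intervalIntegral.integral_interval_sub_left hh (hh.mono_set hsub)]

theorem continuousOn_excessConsumption (hT : 0 ≤ T) {h : ℝ → ℝ}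
    (hh : IntervalIntegrable h volume 0 T) :
    ContinuousOn (excessConsumption T h) (Icc 0 T) :=
  (continuousOn_consumptionScale.mul (continuousOn_const.sub
    (continuousOn_integral_of_intervalIntegrable hT hh))).congr
    fun _ ht => excessConsumption_eq hT hh ht

/-- Since `q' = q ^ 2`, the consumption `D = q ∫_t^T h` satisfies `D' = -q (h - D)` almost
everywhere. Thus `R + D` is constant, the equality case of Jensen's inequality. -/
theorem integral_rate_add_excessConsumption (hT : 0 ≤ T) {h : ℝ → ℝ}
    (hh : IntervalIntegrable h volume 0 T) {t : ℝ} (ht : t ∈ Icc 0 T) :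
    (∫ s in (0 : ℝ)..t, consumptionScale T s * (h s - excessConsumption T h s)) +
      excessConsumption T h t = excessConsumption T h 0 := by
  have hsub : uIcc 0 t ⊆ uIcc 0 T := by
    rw [uIcc_of_le ht.1, uIcc_of_le hT]
    exact Icc_subset_Icc_right ht.2
  have hsub' : uIcc 0 t ⊆ Icc 0 T := by rwa [← uIcc_of_le hT]
  have hht := hh.mono_set hsub
  set I := ∫ s in (0 : ℝ)..T, h s with hI
  have hq : AbsolutelyContinuousOnInterval (consumptionScale T) 0 t :=
    (contDiffOn_consumptionScale.mono hsub').absolutelyContinuousOnInterval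
  have hc : AbsolutelyContinuousOnInterval (fun _ : ℝ => I) 0 t :=
    contDiffOn_const.absolutelyContinuousOnInterval
  have hK := hc.fun_sub (hht.absolutelyContinuousOnInterval_intervalIntegral left_mem_uIcc)
  have hac := (hq.fun_mul hK).integral_deriv_eq_sub
  have hcongr : ∫ s in (0 : ℝ)..t,
      deriv (fun x => consumptionScale T x * (I - ∫ v in (0 : ℝ)..x, h v)) s =
      ∫ s in (0 : ℝ)..t, -(consumptionScale T s * (h s - excessConsumption T h s)) := by
    refine intervalIntegral.integral_congr_ae ?_
    filter_upwards [hht.ae_hasDerivAt_integral] with s hs hsI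
    have hsI' := uIoc_subset_uIcc hsI
    have hd := hs hsI' 0 left_mem_uIcc
    rw [((hasDerivAt_consumptionScale (hsub' hsI').2).fun_mul (hd.const_sub I)).deriv,
      excessConsumption_eq hT hh (hsub' hsI')]
    ring
  rw [hcongr, intervalIntegral.integral_neg] at hac
  rw [excessConsumption_eq hT hh ht, excessConsumption_eq hT hh ⟨le_rfl, hT⟩]
  linarith

theorem intervalIntegrable_rate (hT : 0 ≤ T) {h D : ℝ → ℝ}
    (hh : IntervalIntegrable h volume 0 T) (hD : ContinuousOn D (Icc 0 T)) :
    IntervalIntegrable (fun t => consumptionScale T t * (h t - D t)) volume 0 T := by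
  rw [← uIcc_of_le hT] at hD
  refine (hh.sub hD.intervalIntegrable).continuousOn_mul ?_
  rw [uIcc_of_le hT]
  exact continuousOn_consumptionScale

theorem intervalIntegrable_kernel (hT : 0 ≤ T) (hr : IntervalIntegrable r volume 0 T)
    {D : ℝ → ℝ} (hD : ContinuousOn D (Icc 0 T)) :
    IntervalIntegrable (fun t => Real.exp (-a * ∫ s in (0 : ℝ)..t, r s) *
      (r t + caraUtility a (D t))) volume 0 T := by
  refine intervalIntegrable_exp_mul hT hr (hr.add (ContinuousOn.intervalIntegrable ?_)) (-a)
  rw [uIcc_of_le hT]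
  unfold caraUtility
  fun_prop

theorem integral_kernel_excessConsumption (ha : 0 < a) (hT : 0 < T) {h : ℝ → ℝ}
    (hh : IntervalIntegrable h volume 0 T) :
    ∫ t in (0 : ℝ)..T, Real.exp (-a * ∫ s in (0 : ℝ)..t,
        consumptionScale T s * (h s - excessConsumption T h s)) *
      (consumptionScale T t * (h t - excessConsumption T h t) +
        caraUtility a (excessConsumption T h t)) =
      1 / a * (1 - (T + 1) * Real.exp (-(a / (T + 1)) * ∫ s in (0 : ℝ)..T, h s)) := by
  have hD := continuousOn_excessConsumption hT.le hh
  have hr := intervalIntegrable_rate hT.le hh hD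
  rw [(integral_kernel_eq ha.ne' hT.le hr (intervalIntegrable_kernel hT.le hr hD)).2]
  have h0 : excessConsumption T h 0 = (T + 1)⁻¹ * ∫ s in (0 : ℝ)..T, h s := by
    simp [excessConsumption, consumptionScale]
  have hTT : excessConsumption T h T = 0 := by simp [excessConsumption]
  have hend := integral_rate_add_excessConsumption hT.le hh (t := T) ⟨hT.le, le_rfl⟩
  rw [hTT, add_zero] at hend
  have hconst : ∫ t in (0 : ℝ)..T, Real.exp (-a * ((∫ s in (0 : ℝ)..t,
      consumptionScale T s * (h s - excessConsumption T h s)) + excessConsumption T h t)) =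
      ∫ _ in (0 : ℝ)..T, Real.exp (-a * excessConsumption T h 0) := by
    refine intervalIntegral.integral_congr fun t ht => ?_
    rw [uIcc_of_le hT.le] at ht
    simp only [integral_rate_add_excessConsumption hT.le hh ht]
  rw [hend, hconst, intervalIntegral.integral_const, h0, smul_eq_mul]
  have : -a * ((T + 1)⁻¹ * ∫ s in (0 : ℝ)..T, h s) = -(a / (T + 1)) * ∫ s in (0 : ℝ)..T, h s := by
    ring
  rw [this]
  ring

end RealAnalysis

/-! ### Optimal policies and the value against a selector -/

section Global

theorem aemeasurable_restrict_Ioc_of_domRestrict {β : Type*} [MeasurableSpace β] {T : ℝ}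
    (hT : 0 ≤ T) {g : ℝ → β} (hg : Measurable ((Icc 0 T).domRestrict g)) :
    AEMeasurable g (volume.restrict (Ioc 0 T)) := by
  refine ⟨IccExtend hT ((Icc 0 T).domRestrict g), hg.comp continuous_projIcc.measurable, ?_⟩
  filter_upwards [ae_restrict_mem measurableSet_Ioc] with t ht
  rw [IccExtend_of_mem hT _ ⟨ht.1.le, ht.2⟩]
  rfl

variable {d : ℕ} {ε a T : ℝ}

theorem globalKernel_le_coe {ξ : (ℝ → EuclideanSpace ℝ (Fin d)) × (ℝ → ℝ)}
    {θ : ℝ → LevyTriplet d ε} {v : ℝ}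
    (h : IntervalIntegrable (kernelRate a T ξ θ) volume 0 T →
      IntervalIntegrable (kernelIntegrand a T ξ θ) volume 0 T →
      ∫ t in (0 : ℝ)..T, kernelIntegrand a T ξ θ t ≤ v) :
    globalKernel a T ξ θ ≤ v := by
  rw [globalKernel]
  split_ifs with hi
  · exact EReal.coe_le_coe_iff.2 (h hi.1 hi.2)
  · exact bot_le

theorem kernelIntegrand_eq (ξ : (ℝ → EuclideanSpace ℝ (Fin d)) × (ℝ → ℝ))
    (θ : ℝ → LevyTriplet d ε) : kernelIntegrand a T ξ θ = fun t =>
      Real.exp (-a * ∫ s in (0 : ℝ)..t, kernelRate a T ξ θ s) *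
        (kernelRate a T ξ θ t + caraUtility a (ξ.2 t)) := by
  funext t
  rw [kernelIntegrand, intervalIntegral.integral_const_mul]

/-- The policy that is optimal against `θ`. -/
def optimalPolicy (a T : ℝ) (θ : ℝ → LevyTriplet d ε) :
    (ℝ → EuclideanSpace ℝ (Fin d)) × (ℝ → ℝ) :=
  (fun t => (a * consumptionScale T t)⁻¹ • unitArgmax (θ t),
    excessConsumption T fun t =>
      localKernel a T t (θ t) ((a * consumptionScale T t)⁻¹ • unitArgmax (θ t)))

theorem localKernel_optimalPolicy {t : ℝ} (hb : 0 < a * consumptionScale T t)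
    (θ : ℝ → LevyTriplet d ε) (p : LevyTriplet d ε) :
    localKernel a T t p ((optimalPolicy a T θ).1 t) =
      (a * consumptionScale T t)⁻¹ * unitKernel p (unitArgmax (θ t)) := by
  rw [localKernel_eq hb, optimalPolicy, smul_inv_smul₀ hb.ne']

/-- The factor `q_t` in the Sharpe bound cancels the scale, and `-log q_t = log (T - t + 1)` is at
most `log (T + 1)`; the bound is uniform in time and position. -/
theorem localKernel_le_of_sharpe (ha : 0 < a) {t : ℝ} (ht : t ∈ Icc 0 T)
    {p : LevyTriplet d ε}
    (hp : p.drift.ofLp ⬝ᵥ (p.cov⁻¹).mulVec p.drift.ofLp ≤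
      2 * consumptionScale T t * (1 - Real.log (consumptionScale T t)))
    (x : EuclideanSpace ℝ (Fin d)) :
    localKernel a T t p x ≤ a⁻¹ * (1 + Real.log (T + 1)) := by
  have hq : 0 < consumptionScale T t := consumptionScale_pos ht.2
  have hb : 0 < a * consumptionScale T t := by positivity
  rw [localKernel_eq hb]
  have h1 := unitKernel_le_half_sharpe p ((a * consumptionScale T t) • x)
  have h2 : -Real.log (consumptionScale T t) ≤ Real.log (T + 1) := by
    rw [consumptionScale, Real.log_inv, neg_neg]
    exact Real.log_le_log (by linarith [ht.2]) (by linarith [ht.1])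
  calc (a * consumptionScale T t)⁻¹ * unitKernel p ((a * consumptionScale T t) • x)
      ≤ (a * consumptionScale T t)⁻¹ *
        (1 / 2 * (2 * consumptionScale T t * (1 + Real.log (T + 1)))) := by
        gcongr
        refine h1.trans ?_
        gcongr
        refine hp.trans ?_
        gcongr
        linarith
    _ = _ := by field_simp

variable {Θ : ℝ → Set (LevyTriplet d ε)}

theorem measurable_localKernel (ha : 0 < a) (hε : 0 < ε) (hε2 : ε ≤ 2)
    (hΘ : ∀ t ∈ Icc 0 T, HasRegularJumps (Θ t)) {θ : ℝ → LevyTriplet d ε}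
    (hθ : θ ∈ selectors T Θ) {w : ℝ → EuclideanSpace ℝ (Fin d)}
    (hw : Measurable ((Icc 0 T).domRestrict w)) :
    Measurable ((Icc 0 T).domRestrict fun t => localKernel a T t (θ t) (w t)) := by
  have hq : Measurable fun t : Icc 0 T => a * consumptionScale T t :=
    (continuousOn_consumptionScale.domRestrict.measurable).const_mul a
  have h1 : Measurable fun t : Icc 0 T => (a * consumptionScale T t) • w t := hq.smul hw
  have h2 := measurable_unitKernel_comp hε hε2 (θ := (Icc 0 T).domRestrict θ) hθ.1
    (fun t => (hΘ t t.2).subset_boundedTriplets (hθ.2 t t.2)) h1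
  have h3 : ((Icc 0 T).domRestrict fun t => localKernel a T t (θ t) (w t)) =
      fun t : Icc 0 T => (a * consumptionScale T t)⁻¹ *
        unitKernel ((Icc 0 T).domRestrict θ t) ((a * consumptionScale T t) • w t) := by
    funext t
    exact localKernel_eq (mul_pos ha (consumptionScale_pos t.2.2)) _ _
  rw [h3]
  exact hq.inv.mul h2

theorem measurable_optimalPolicy_fst (hε : 0 < ε) (hε2 : ε ≤ 2)
    (hΘ : ∀ t ∈ Icc 0 T, HasRegularJumps (Θ t)) {θ : ℝ → LevyTriplet d ε}
    (hθ : θ ∈ selectors T Θ) : Measurable ((Icc 0 T).domRestrict (optimalPolicy a T θ).1) := by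
  have hq : Measurable fun t : Icc 0 T => (a * consumptionScale T t)⁻¹ :=
    ((continuousOn_consumptionScale.domRestrict.measurable).const_mul a).inv
  have h1 := measurable_unitArgmax hε hε2 (θ := (Icc 0 T).domRestrict θ) hθ.1
    (fun t => (hΘ t t.2).subset_boundedTriplets (hθ.2 t t.2))
  exact hq.smul h1

theorem localKernel_le_optimalPolicy (ha : 0 < a) (hε : 0 < ε) (hε2 : ε ≤ 2)
    (hΘ : ∀ t ∈ Icc 0 T, HasRegularJumps (Θ t)) {θ : ℝ → LevyTriplet d ε}
    (hθ : θ ∈ selectors T Θ) {t : ℝ} (ht : t ∈ Icc 0 T) (x : EuclideanSpace ℝ (Fin d)) :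
    localKernel a T t (θ t) x ≤ localKernel a T t (θ t) ((optimalPolicy a T θ).1 t) := by
  have hb : 0 < a * consumptionScale T t := mul_pos ha (consumptionScale_pos ht.2)
  rw [localKernel_optimalPolicy hb, localKernel_eq hb]
  gcongr
  exact unitKernel_le_argmax hε hε2 ((hΘ t ht).subset_boundedTriplets (hθ.2 t ht)) _

theorem localKernel_zero (ha : 0 < a) {t : ℝ} (ht : t ∈ Icc 0 T) (p : LevyTriplet d ε) :
    localKernel a T t p 0 = 0 := by
  rw [localKernel_eq (mul_pos ha (consumptionScale_pos ht.2)), smul_zero, unitKernel_zero, mul_zero]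

/-- The Sharpe condition bounds the local values only from above, so nonnegativity has to supply the
other side. -/
theorem intervalIntegrable_localKernel (ha : 0 < a) (hT : 0 ≤ T) (hε : 0 < ε) (hε2 : ε ≤ 2)
    (hΘ : ∀ t ∈ Icc 0 T, HasRegularJumps (Θ t))
    (hΘs : ∀ t ∈ Icc 0 T, ∀ p ∈ Θ t, p.drift.ofLp ⬝ᵥ (p.cov⁻¹).mulVec p.drift.ofLp ≤
      2 * consumptionScale T t * (1 - Real.log (consumptionScale T t)))
    {θ : ℝ → LevyTriplet d ε} (hθ : θ ∈ selectors T Θ) {w : ℝ → EuclideanSpace ℝ (Fin d)}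
    (hw : Measurable ((Icc 0 T).domRestrict w))
    (h0 : ∀ t ∈ Icc 0 T, 0 ≤ localKernel a T t (θ t) (w t)) :
    IntervalIntegrable (fun t => localKernel a T t (θ t) (w t)) volume 0 T := by
  rw [intervalIntegrable_iff_integrableOn_Ioc_of_le hT]
  refine Integrable.of_bound (C := a⁻¹ * (1 + Real.log (T + 1)))
    (aemeasurable_restrict_Ioc_of_domRestrict hT
      (measurable_localKernel ha hε hε2 hΘ hθ hw)).aestronglyMeasurable ?_
  filter_upwards [ae_restrict_mem measurableSet_Ioc] with t ht
  have ht' : t ∈ Icc 0 T := ⟨ht.1.le, ht.2⟩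
  rw [Real.norm_eq_abs, abs_of_nonneg (h0 t ht')]
  exact localKernel_le_of_sharpe ha ht' (hΘs t ht' _ (hθ.2 t ht')) _

theorem localKernel_optimalPolicy_nonneg (ha : 0 < a) (hε : 0 < ε) (hε2 : ε ≤ 2)
    (hΘ : ∀ t ∈ Icc 0 T, HasRegularJumps (Θ t)) {θ : ℝ → LevyTriplet d ε}
    (hθ : θ ∈ selectors T Θ) {t : ℝ} (ht : t ∈ Icc 0 T) :
    0 ≤ localKernel a T t (θ t) ((optimalPolicy a T θ).1 t) := by
  have := localKernel_le_optimalPolicy ha hε hε2 hΘ hθ ht 0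
  rwa [localKernel_zero ha ht] at this

theorem intervalIntegrable_localKernel_optimalPolicy (ha : 0 < a) (hT : 0 ≤ T) (hε : 0 < ε)
    (hε2 : ε ≤ 2) (hΘ : ∀ t ∈ Icc 0 T, HasRegularJumps (Θ t))
    (hΘs : ∀ t ∈ Icc 0 T, ∀ p ∈ Θ t, p.drift.ofLp ⬝ᵥ (p.cov⁻¹).mulVec p.drift.ofLp ≤
      2 * consumptionScale T t * (1 - Real.log (consumptionScale T t)))
    {θ : ℝ → LevyTriplet d ε} (hθ : θ ∈ selectors T Θ) :
    IntervalIntegrable (fun t => localKernel a T t (θ t) ((optimalPolicy a T θ).1 t))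
      volume 0 T :=
  intervalIntegrable_localKernel ha hT hε hε2 hΘ hΘs hθ
    (measurable_optimalPolicy_fst hε hε2 hΘ hθ)
    fun _ ht => localKernel_optimalPolicy_nonneg ha hε hε2 hΘ hθ ht

theorem optimalPolicy_mem (ha : 0 < a) (hT : 0 ≤ T) (hε : 0 < ε) (hε2 : ε ≤ 2)
    (hΘ : ∀ t ∈ Icc 0 T, HasRegularJumps (Θ t))
    (hΘs : ∀ t ∈ Icc 0 T, ∀ p ∈ Θ t, p.drift.ofLp ⬝ᵥ (p.cov⁻¹).mulVec p.drift.ofLp ≤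
      2 * consumptionScale T t * (1 - Real.log (consumptionScale T t)))
    {θ : ℝ → LevyTriplet d ε} (hθ : θ ∈ selectors T Θ) :
    optimalPolicy a T θ ∈ deterministicPolicies d T :=
  ⟨measurable_optimalPolicy_fst hε hε2 hΘ hθ, (continuousOn_excessConsumption hT
    (intervalIntegrable_localKernel_optimalPolicy ha hT hε hε2 hΘ hΘs hθ)).domRestrict.measurable⟩

/-- The value of the global kernel when consumption is optimal for the local values. -/
def optimalValue (a T : ℝ) (θ : ℝ → LevyTriplet d ε) : ℝ :=
  1 / a * (1 - (T + 1) * Real.exp (-(a / (T + 1)) *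
    ∫ s in (0 : ℝ)..T, localKernel a T s (θ s) ((optimalPolicy a T θ).1 s)))

theorem globalKernel_le_optimalValue (ha : 0 < a) (hT : 0 < T) (hε : 0 < ε) (hε2 : ε ≤ 2)
    (hΘ : ∀ t ∈ Icc 0 T, HasRegularJumps (Θ t))
    (hΘs : ∀ t ∈ Icc 0 T, ∀ p ∈ Θ t, p.drift.ofLp ⬝ᵥ (p.cov⁻¹).mulVec p.drift.ofLp ≤
      2 * consumptionScale T t * (1 - Real.log (consumptionScale T t)))
    {θ : ℝ → LevyTriplet d ε} (hθ : θ ∈ selectors T Θ)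
    {ξ : (ℝ → EuclideanSpace ℝ (Fin d)) × (ℝ → ℝ)} (hξ : ξ ∈ deterministicPolicies d T) :
    globalKernel a T ξ θ ≤ optimalValue a T θ := by
  refine globalKernel_le_coe fun hr hi => ?_
  rw [kernelIntegrand_eq] at hi ⊢
  obtain ⟨h1, h2⟩ := integral_kernel_le ha hT
    (h := fun t => localKernel a T t (θ t) (ξ.1 t)) (D := ξ.2) hr hi
    (fun t ht => localKernel_le_of_sharpe ha ht (hΘs t ht _ (hθ.2 t ht)) _)
    (aemeasurable_restrict_Ioc_of_domRestrict hT.le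
      (measurable_localKernel ha hε hε2 hΘ hθ hξ.1)).aestronglyMeasurable
  refine h2.trans ?_
  have h3 := intervalIntegral.integral_mono_on hT.le h1
    (intervalIntegrable_localKernel_optimalPolicy ha hT.le hε hε2 hΘ hΘs hθ)
    fun t ht => localKernel_le_optimalPolicy ha hε hε2 hΘ hθ ht (ξ.1 t)
  have h4 : 0 ≤ a / (T + 1) := by positivity
  unfold optimalValue
  gcongr 1 / a * (1 - (T + 1) * Real.exp ?_)
  nlinarith

/-- The policy is tuned to `θ` but evaluated against `θ'`. Its consumption is continuous, so only
integrability of the local values under `θ'` is at stake. -/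
theorem integrable_kernel_optimalPolicy (ha : 0 < a) (hT : 0 < T) (hε : 0 < ε) (hε2 : ε ≤ 2)
    (hΘ : ∀ t ∈ Icc 0 T, HasRegularJumps (Θ t))
    (hΘs : ∀ t ∈ Icc 0 T, ∀ p ∈ Θ t, p.drift.ofLp ⬝ᵥ (p.cov⁻¹).mulVec p.drift.ofLp ≤
      2 * consumptionScale T t * (1 - Real.log (consumptionScale T t)))
    {θ θ' : ℝ → LevyTriplet d ε} (hθ : θ ∈ selectors T Θ) (hθ' : θ' ∈ selectors T Θ)
    (h0 : ∀ t ∈ Icc 0 T, 0 ≤ localKernel a T t (θ' t) ((optimalPolicy a T θ).1 t)) :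
    IntervalIntegrable (kernelRate a T (optimalPolicy a T θ) θ') volume 0 T ∧
      IntervalIntegrable (kernelIntegrand a T (optimalPolicy a T θ) θ') volume 0 T := by
  have hD := continuousOn_excessConsumption hT.le
    (intervalIntegrable_localKernel_optimalPolicy ha hT.le hε hε2 hΘ hΘs hθ)
  have hr : IntervalIntegrable (kernelRate a T (optimalPolicy a T θ) θ') volume 0 T :=
    intervalIntegrable_rate hT.le (intervalIntegrable_localKernel ha hT.le hε hε2 hΘ hΘs hθ'
      (measurable_optimalPolicy_fst hε hε2 hΘ hθ) h0) hD
  refine ⟨hr, ?_⟩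
  rw [kernelIntegrand_eq]
  exact intervalIntegrable_kernel hT.le hr hD

theorem globalKernel_optimalPolicy (ha : 0 < a) (hT : 0 < T) (hε : 0 < ε) (hε2 : ε ≤ 2)
    (hΘ : ∀ t ∈ Icc 0 T, HasRegularJumps (Θ t))
    (hΘs : ∀ t ∈ Icc 0 T, ∀ p ∈ Θ t, p.drift.ofLp ⬝ᵥ (p.cov⁻¹).mulVec p.drift.ofLp ≤
      2 * consumptionScale T t * (1 - Real.log (consumptionScale T t)))
    {θ : ℝ → LevyTriplet d ε} (hθ : θ ∈ selectors T Θ) :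
    globalKernel a T (optimalPolicy a T θ) θ = optimalValue a T θ := by
  rw [globalKernel, if_pos (integrable_kernel_optimalPolicy ha hT hε hε2 hΘ hΘs hθ hθ
    fun t ht => localKernel_optimalPolicy_nonneg ha hε hε2 hΘ hθ ht), kernelIntegrand_eq]
  congr 1
  exact integral_kernel_excessConsumption ha hT
    (intervalIntegrable_localKernel_optimalPolicy ha hT.le hε hε2 hΘ hΘs hθ)

/-- The global kernel is monotone in the local kernel. -/
theorem globalKernel_mono (ha : 0 < a) (hT : 0 < T)
    {ξ : (ℝ → EuclideanSpace ℝ (Fin d)) × (ℝ → ℝ)} {θ θ' : ℝ → LevyTriplet d ε}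
    (hle : ∀ t ∈ Icc 0 T,
      localKernel a T t (θ t) (ξ.1 t) ≤ localKernel a T t (θ' t) (ξ.1 t))
    (hi' : IntervalIntegrable (kernelRate a T ξ θ') volume 0 T ∧
      IntervalIntegrable (kernelIntegrand a T ξ θ') volume 0 T) :
    globalKernel a T ξ θ ≤ globalKernel a T ξ θ' := by
  rw [globalKernel.eq_1 a T ξ θ', if_pos hi']
  refine globalKernel_le_coe fun hr hi => ?_
  rw [kernelIntegrand_eq] at hi hi' ⊢
  rw [kernelIntegrand_eq]
  refine integral_kernel_mono ha hT.le hr hi'.1 (fun t ht => ?_) hi hi'.2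
  have := consumptionScale_pos ht.2
  have := hle t ht
  simp only [kernelRate]
  gcongr

theorem exists_selector_of_measurable (hT : 0 ≤ T) {P : ℝ → LevyTriplet d ε → Prop}
    (h : ∃ θ : Icc 0 T → LevyTriplet d ε, Measurable θ ∧
      ∀ t : Icc 0 T, θ t ∈ Θ t ∧ P t (θ t)) :
    ∃ θ ∈ selectors T Θ, ∀ t ∈ Icc 0 T, P t (θ t) := by
  obtain ⟨θ, hm, hθ⟩ := h
  have heq : (Icc 0 T).domRestrict (IccExtend hT θ) = θ := by
    funext t
    exact IccExtend_of_mem hT θ t.2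
  refine ⟨IccExtend hT θ, ⟨by rwa [heq], fun t ht => ?_⟩, fun t ht => ?_⟩
  · rw [IccExtend_of_mem hT θ ht]
    exact (hθ ⟨t, ht⟩).1
  · rw [IccExtend_of_mem hT θ ht]
    exact (hθ ⟨t, ht⟩).2

theorem WeaklyMeasurableOn.measurableSet_subtype {X : Type*} [TopologicalSpace X]
    {Θ : ℝ → Set X} (h : WeaklyMeasurableOn T Θ) {G : Set X} (hG : IsOpen G) :
    MeasurableSet {t : Icc 0 T | (Θ t ∩ G).Nonempty} := by
  convert measurable_subtype_coe (h G hG) using 1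
  ext t
  exact ⟨fun h => ⟨t.2, h⟩, fun h => h.2⟩

end Global

theorem mainTheorem4 (d : ℕ) (a T ε : ℝ) (ha : 0 < a) (hT : 0 < T) (hε : 0 < ε) (hε2 : ε ≤ 2)
    (C : Set (LevyTriplet d ε)) (hC : IsCompact C)
    (Θ : ℝ → Set (LevyTriplet d ε))
    (hΘC : ∀ t ∈ Icc 0 T, Θ t ⊆ C)
    (hΘne : ∀ t ∈ Icc 0 T, (Θ t).Nonempty)
    (hΘmeas : WeaklyMeasurableOn T Θ)
    (hΘclosed : ∀ t ∈ Icc 0 T, IsClosed (Θ t))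
    (hΘconvex : ∀ t ∈ Icc 0 T, Convex ℝ≥0 (LevyTriplet.toProd '' Θ t))
    (hΘjumps : ∀ t ∈ Icc 0 T, HasRegularJumps (Θ t))
    (hΘsharpe : ∀ t ∈ Icc 0 T, ∀ p ∈ Θ t,
      p.drift.ofLp ⬝ᵥ (p.cov⁻¹).mulVec p.drift.ofLp ≤
        2 * consumptionScale T t * (1 - Real.log (consumptionScale T t))) :
    ∃ ξ ∈ deterministicPolicies d T, ∃ θ ∈ selectors T Θ,
      -- saddle point of the global kernel (minimized in the triplet, maximized in the policy)
      IsSaddlePointOn (selectors T Θ) (deterministicPolicies d T)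
        (fun θ' ξ' => globalKernel a T ξ' θ') θ ξ ∧
      -- saddle points of the local kernels
      (∀ t ∈ Icc 0 T, IsSaddlePointOn (Θ t) univ (localKernel a T t) (θ t) (ξ.1 t)) ∧
      -- the excess consumption
      IntervalIntegrable (fun s => localKernel a T s (θ s) (ξ.1 s)) volume 0 T ∧
      (∀ t ∈ Icc 0 T, ξ.2 t =
        consumptionScale T t * ∫ s in t..T, localKernel a T s (θ s) (ξ.1 s)) ∧
      -- the value
      IsMinMax (selectors T Θ) (deterministicPolicies d T)
        (fun θ' ξ' => globalKernel a T ξ' θ') (globalKernel a T ξ θ) ∧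
      IsMaxMin (selectors T Θ) (deterministicPolicies d T)
        (fun θ' ξ' => globalKernel a T ξ' θ') (globalKernel a T ξ θ) ∧
      globalKernel a T ξ θ =
        ((1 / a * (1 - (T + 1) * Real.exp (-(a / (T + 1)) *
          ∫ s in (0 : ℝ)..T, localKernel a T s (θ s) (ξ.1 s))) : ℝ) : EReal) := by
  obtain ⟨θ, hθ, hmin⟩ := exists_selector_of_measurable hT.le
    (P := fun t q => ∀ p ∈ Θ t, unitKernel q (unitArgmax q) ≤ unitKernel p (unitArgmax p))
    (exists_measurable_minimizer_max (S := fun t : Icc 0 T => Θ t) hε hε2 hC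
      (fun t => hΘC t t.2) (fun t => hΘne t t.2) (fun t => hΘclosed t t.2)
      (fun G hG => hΘmeas.measurableSet_subtype hG) fun t => hΘjumps t t.2)
  set ξ := optimalPolicy a T θ
  have hξ : ξ ∈ deterministicPolicies d T := optimalPolicy_mem ha hT.le hε hε2 hΘjumps hΘsharpe hθ
  have hloc : ∀ t ∈ Icc 0 T, ∀ p ∈ Θ t,
      localKernel a T t (θ t) (ξ.1 t) ≤ localKernel a T t p (ξ.1 t) := by
    intro t ht p hp
    have hb : 0 < a * consumptionScale T t := mul_pos ha (consumptionScale_pos ht.2)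
    rw [localKernel_optimalPolicy hb, localKernel_optimalPolicy hb]
    gcongr
    exact unitKernel_saddle hε hε2 (hΘjumps t ht).subset_boundedTriplets (hΘconvex t ht)
      (hθ.2 t ht) (hmin t ht) hp
  have hvalue : ∀ θ' ∈ selectors T Θ, IsGreatest
      ((fun ξ' => globalKernel a T ξ' θ') '' deterministicPolicies d T)
      (globalKernel a T (optimalPolicy a T θ') θ') := by
    intro θ' hθ'
    refine ⟨⟨_, optimalPolicy_mem ha hT.le hε hε2 hΘjumps hΘsharpe hθ', rfl⟩, ?_⟩
    rintro _ ⟨ξ', hξ', rfl⟩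
    rw [globalKernel_optimalPolicy ha hT hε hε2 hΘjumps hΘsharpe hθ']
    exact globalKernel_le_optimalValue ha hT hε hε2 hΘjumps hΘsharpe hθ' hξ'
  have hlow : ∀ θ' ∈ selectors T Θ, globalKernel a T ξ θ ≤ globalKernel a T ξ θ' := by
    intro θ' hθ'
    have hle := fun t ht => hloc t ht (θ' t) (hθ'.2 t ht)
    -- Against any `θ'`, the local values at `ξ` dominate the saddle values, which are nonnegative
    -- by comparison with position `0`; so the value `⊥` cannot occur here.
    exact globalKernel_mono ha hT hle (integrable_kernel_optimalPolicy ha hT hε hε2 hΘjumps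
      hΘsharpe hθ hθ' fun t ht =>
        (localKernel_optimalPolicy_nonneg ha hε hε2 hΘjumps hθ ht).trans (hle t ht))
  have hup : ∀ ξ' ∈ deterministicPolicies d T, globalKernel a T ξ' θ ≤ globalKernel a T ξ θ :=
    fun ξ' hξ' => (hvalue θ hθ).2 ⟨ξ', hξ', rfl⟩
  have hleast : IsLeast ((fun θ' => globalKernel a T ξ θ') '' selectors T Θ)
      (globalKernel a T ξ θ) :=
    ⟨⟨θ, hθ, rfl⟩, by rintro _ ⟨θ', hθ', rfl⟩; exact hlow θ' hθ'⟩
  refine ⟨ξ, hξ, θ, hθ, fun θ' hθ' ξ' hξ' => (hup ξ' hξ').trans (hlow θ' hθ'),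
    fun t ht p hp x _ => ?_,
    intervalIntegrable_localKernel_optimalPolicy ha hT.le hε hε2 hΘjumps hΘsharpe hθ,
    fun t _ => rfl, ⟨fun θ' hθ' => ⟨_, hvalue θ' hθ'⟩, ⟨θ, hθ, hvalue θ hθ⟩, ?_⟩,
    ⟨fun ξ' hξ' => ?_, ⟨ξ, hξ, hleast⟩, ?_⟩,
    globalKernel_optimalPolicy ha hT hε hε2 hΘjumps hΘsharpe hθ⟩
  · exact (localKernel_le_optimalPolicy ha hε hε2 hΘjumps hθ ht x).trans (hloc t ht p hp)
  · rintro m ⟨θ', hθ', hm⟩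
    exact (hlow θ' hθ').trans (hm.2 ⟨ξ, hξ, rfl⟩)
  -- For an arbitrary policy the minimum is attained either at a selector giving `⊥` or, if all
  -- integrability conditions hold, at a measurable pointwise minimizer of the local kernel, by
  -- monotonicity.
  · by_cases hbot : ∃ θ' ∈ selectors T Θ, globalKernel a T ξ' θ' = ⊥
    · obtain ⟨θ', hθ', hb⟩ := hbot
      exact ⟨⊥, ⟨θ', hθ', hb⟩, fun _ _ => bot_le⟩
    push Not at hbot
    have hq : Measurable fun t : Icc 0 T => (a * consumptionScale T t) • ξ'.1 t :=
      ((continuousOn_consumptionScale.domRestrict.measurable).const_mul a).smul hξ'.1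
    obtain ⟨η, hη, hηmin⟩ := exists_selector_of_measurable hT.le
      (P := fun t q => ∀ p ∈ Θ t, unitKernel q ((a * consumptionScale T t) • ξ'.1 t) ≤
        unitKernel p ((a * consumptionScale T t) • ξ'.1 t))
      (exists_measurable_minimizer_at (S := fun t : Icc 0 T => Θ t) hε hε2 hC
        (fun t => hΘC t t.2) (fun t => hΘne t t.2) (fun t => hΘclosed t t.2)
        (fun G hG => hΘmeas.measurableSet_subtype hG) (fun t => hΘjumps t t.2) hq)
    refine ⟨_, ⟨η, hη, rfl⟩, ?_⟩
    rintro _ ⟨θ', hθ', rfl⟩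
    refine globalKernel_mono ha hT (fun t ht => ?_) ?_
    · have hb : 0 < a * consumptionScale T t := mul_pos ha (consumptionScale_pos ht.2)
      rw [localKernel_eq hb, localKernel_eq hb]
      gcongr
      exact hηmin t ht (θ' t) (hθ'.2 t ht)
    · by_contra hi
      exact hbot θ' hθ' (if_neg hi)
  · rintro m ⟨ξ', hξ', hm⟩
    exact (hm.2 ⟨θ, hθ, rfl⟩).trans (hup ξ' hξ')

end
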